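/- **Notation.** Let $m(\xi)=\sqrt{\tanh(\xi)/\xi}$ (with $m(0)=1$) and let $$K(x)=\frac1{2\pi}\int_{\mathbb R} m(\xi)e^{ix\xi}\,d\xi=\lim_{R\to\infty}\frac1{2\pi}\int_{-R}^{R} m(\xi)e^{ix\xi}\,d\xi\qquad(x\neq0)$$ be the Whitham kernel. Let $Lf(x)=\int_{\mathbb R}K(x-y)f(y)\,dy$ for bounded continuous $f$, and, for $0<P<\infty$, let $K_P(x)=\sum_{n\in\mathbb Z}K(x+nP)$ for $x\notin P\mathbb Z$. For $\mu\in\mathbb R$, a solution of the steady Whitham equation is a bounded continuous function $\varphi\colon\mathbb R\to\mathbb R$ with $-\mu\varphi+L\varphi+\varphi^2=0$ on $\mathbb R$. $BUC^k(\mathbb R)$ is the space of $k$ times continuously differentiable functions on $\mathbb R$ whose derivatives of order at most $k$ are bounded and uniformly continuous. For $P=\infty$, $P$-periodicity is no condition and $(-P/2,0)$ means $(-\infty,0)$. **Theorem 3.8 (Nodal pattern).** Let $P\in(0,\infty]$ and $\mu\in\mathbb R$, and let $\varphi\in BUC^1(\mathbb R)$ be a $P$-periodic, even, nonconstant solution of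 the steady Whitham equation that is nondecreasing on $(-P/2,0)$. Then $$\varphi'>0\quad\text{and}\quad\varphi<\frac\mu2\qquad\text{on }(-P/2,0),$$ and $\mu>0$. If furthermore $\varphi\in BUC^2(\mathbb R)$, then $\varphi<\frac\mu2$ everywhere on $\mathbb R$ and $\varphi''(0)<0$. If $\varphi\in BUC^2(\mathbb R)$ and $P<\infty$, then also $\varphi''(\pm P/2)>0$; and if in addition $\mu\le1$ and $\varphi(0)\ge\frac\mu4$, then $K_P$ is differentiable at $P/4$ and $$\varphi''\!\left(\tfrac P2\right)-\varphi''(0)\ \ge\ \tfrac12\left|K_P'\!\left(\tfrac P4\right)\right|.$$ -/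

import Mathlib

open Filter MeasureTheory

noncomputable section

namespace Whitham

/-- The Whitham symbol `m(ξ) = √(tanh ξ / ξ)`, extended by continuity with `m(0) = 1`. -/
def symbol (ξ : ℝ) : ℝ :=
  if ξ = 0 then 1 else Real.sqrt (Real.tanh ξ / ξ)

/-- The Whitham kernel `K(x) = (1/2π) ∫ m(ξ) exp(i x ξ) dξ`, the inverse Fourier transform of the
symbol. Since `m` is not (absolutely) integrable, the integral is the improper one, that is, the
limit of the integrals over `[-R, R]`; it converges for every `x ≠ 0`. The kernel is singular at
the origin, and its value there plays no role. The limit is a real number because `m` is even. -/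
def kernel (x : ℝ) : ℝ :=
  (limUnder atTop (fun R : ℝ =>
    (1 / (2 * Real.pi) : ℂ) *
      ∫ ξ in (-R)..R, (symbol ξ : ℂ) * Complex.exp (Complex.I * x * ξ))).re

/-- The periodised kernel `K_P(x) = ∑_{n ∈ ℤ} K(x + n P)` for a finite period `P`. -/
def periodicKernel (P : ℝ) (x : ℝ) : ℝ :=
  ∑' n : ℤ, kernel (x + n * P)

/-- The operator `L f = K ∗ f` on bounded continuous functions. -/
def L (f : ℝ → ℝ) (x : ℝ) : ℝ :=
  ∫ y, kernel (x - y) * f y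

/-- `φ` is a solution of the steady Whitham equation `-μ φ + L φ + φ² = 0`: a real-valued,
continuous and bounded function that satisfies the equation pointwise. -/
structure IsSolution (μ : ℝ) (φ : ℝ → ℝ) : Prop where
  continuous : Continuous φ
  bounded : ∃ C : ℝ, ∀ x, |φ x| ≤ C
  equation : ∀ x, -μ * φ x + L φ x + φ x ^ 2 = 0

/-- The space `BUC^k(ℝ)`: `k` times continuously differentiable functions whose derivatives of
order at most `k` are bounded and uniformly continuous. -/
def BUC (k : ℕ) (φ : ℝ → ℝ) : Prop :=
  ContDiff ℝ k φ ∧ ∀ j ≤ k,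
    UniformContinuous (iteratedDeriv j φ) ∧ ∃ C : ℝ, ∀ x, |iteratedDeriv j φ x| ≤ C

/-- `P`-periodicity for an extended period `P ∈ (0, ∞]`; no condition if `P = ∞`. -/
def IsPeriodic (P : EReal) (φ : ℝ → ℝ) : Prop :=
  ∀ p : ℝ, P = (p : EReal) → Function.Periodic φ p

/-- The open half-period `(-P/2, 0)` for `P ∈ (0, ∞]`; it is `(-∞, 0)` if `P = ∞`. -/
def leftHalfPeriod (P : EReal) : Set ℝ :=
  {x : ℝ | -(P / 2) < (x : EReal) ∧ x < 0}

end Whitham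

end

noncomputable section

namespace Whitham

open Topology Set

/-! The kernel is a superposition of decaying exponentials with nonnegative weights: `K(x) = ∫
density(s) exp(-s|x|) ds` (`kernel_eq`). This comes from turning the Fourier integral from the
positive real axis to the positive imaginary axis, where the chosen root of `tanh z / z` contributes
`√(-tan s / s)` if `tan s < 0` and nothing otherwise. The same rotation applied to a Poisson kernel
gives total mass `1` (`integral_density_div`), so `L` preserves bounds.

Hence `L f x` averages, over `s`, the Laplace transforms of `t ↦ f(x+t) + f(x-t)`
(`L_eq_integral_laplace`), and integration by parts there moves derivatives onto differences of `f`
(`laplace_first_deriv`, `laplace_second_deriv`). For `φ'` this leaves `φ(x+t) - φ(x-t)`, whose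
Laplace transform is positive by reflection and monotonicity (`laplace_diff_pos`); for `φ''` at an
extremum it leaves a second difference of constant sign (`L_second_deriv_pos`).

The differentiated equation `Lφ' = (μ - 2φ)φ'` with `φ' ≥ 0` then makes both factors positive on the
half period. At an extremum `Lφ'' = (μ - 2φ)φ''`: at the crest the strict sign of the left side
excludes `φ(0) = μ/2`, and the signs of `φ''` follow. A comparison of `L` at the supremum and the
infimum gives `μ > 0` (`IsSolution.speed_pos`).

For the quantitative estimate, the second difference is bounded below on the middle half of a
period, which produces exactly `-K_P'(P/4)` (`le_L_second_deriv`); the bounds at crest and trough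
are added. -/

/-! ### A holomorphic square root of `tanh z / z` on the first quadrant. -/

lemma cosh_add_mul_I (a b : ℝ) : Complex.cosh (a + b * Complex.I) =
    ((Real.cosh a * Real.cos b : ℝ) : ℂ) + ((Real.sinh a * Real.sin b : ℝ) : ℂ) * Complex.I := by
  rw [Complex.cosh_add, Complex.cosh_mul_I, Complex.sinh_mul_I]; push_cast; ring

lemma sinh_add_mul_I (a b : ℝ) : Complex.sinh (a + b * Complex.I) =
    ((Real.sinh a * Real.cos b : ℝ) : ℂ) + ((Real.cosh a * Real.sin b : ℝ) : ℂ) * Complex.I := by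
  rw [Complex.sinh_add, Complex.cosh_mul_I, Complex.sinh_mul_I]; push_cast; ring

lemma normSq_cosh_add_mul_I (a b : ℝ) : Complex.normSq (Complex.cosh (a + b * Complex.I)) =
    Real.sinh a ^ 2 + Real.cos b ^ 2 := by
  rw [cosh_add_mul_I, Complex.normSq_add_mul_I]
  have := Real.cosh_sq a
  have := Real.sin_sq_add_cos_sq b
  linear_combination (Real.cos b ^ 2) * Real.cosh_sq a + Real.sinh a ^ 2 * Real.sin_sq_add_cos_sq b

lemma normSq_sinh_add_mul_I (a b : ℝ) : Complex.normSq (Complex.sinh (a + b * Complex.I)) =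
    Real.sinh a ^ 2 + Real.sin b ^ 2 := by
  rw [sinh_add_mul_I, Complex.normSq_add_mul_I]
  linear_combination (Real.sin b ^ 2) * Real.cosh_sq a + Real.sinh a ^ 2 * Real.sin_sq_add_cos_sq b

lemma cosh_add_mul_I_ne_zero {a b : ℝ} (h : a ≠ 0 ∨ Real.cos b ≠ 0) :
    Complex.cosh (a + b * Complex.I) ≠ 0 := by
  rw [← Complex.normSq_pos, normSq_cosh_add_mul_I]
  rcases h with h | h
  · have : Real.sinh a ≠ 0 := by simpa using h
    positivity
  · positivity

lemma add_mul_I_ne_zero {a b : ℝ} (h : a ≠ 0 ∨ b ≠ 0) : (a + b * Complex.I : ℂ) ≠ 0 := by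
  rw [← Complex.normSq_pos, Complex.normSq_add_mul_I]
  rcases h with h | h <;> positivity

/-- `tanh z / z` in Cartesian form. -/
lemma tanh_div_eq (a b : ℝ) :
    Complex.tanh (a + b * Complex.I) / (a + b * Complex.I) =
    (((a * (Real.sinh a * Real.cosh a) + b * (Real.sin b * Real.cos b) : ℝ) : ℂ) +
      ((a * (Real.sin b * Real.cos b) - b * (Real.sinh a * Real.cosh a) : ℝ) : ℂ) * Complex.I) /
      (((Real.sinh a ^ 2 + Real.cos b ^ 2) * (a ^ 2 + b ^ 2) : ℝ) : ℂ) := by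
  -- At `z = 0` and at the poles of `tanh` both sides are `0`, since division by zero gives `0`.
  by_cases h0 : (a + b * Complex.I : ℂ) = 0
  · have ha : a = 0 := by simpa using congrArg Complex.re h0
    have hb : b = 0 := by simpa using congrArg Complex.im h0
    simp [ha, hb]
  by_cases hc : Complex.cosh (a + b * Complex.I) = 0
  · have h := normSq_cosh_add_mul_I a b
    rw [hc] at h
    rw [← h, Complex.tanh_eq_sinh_div_cosh, hc]; simp
  rw [Complex.tanh_eq_sinh_div_cosh, div_div, ← normSq_cosh_add_mul_I,
    ← Complex.normSq_add_mul_I a b, Complex.ofReal_mul, ← Complex.mul_conj, ← Complex.mul_conj]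
  have hc' : (starRingEnd ℂ) (Complex.cosh (a + b * Complex.I)) ≠ 0 := by simpa using hc
  have h0' : (starRingEnd ℂ) (a + b * Complex.I : ℂ) ≠ 0 :=
    (map_ne_zero _).2 h0
  rw [div_eq_div_iff (by positivity) (by positivity)]
  rw [sinh_add_mul_I, cosh_add_mul_I]
  simp only [map_add, map_mul, Complex.conj_ofReal, Complex.conj_I]
  have h1 : ((Real.cosh a : ℝ) : ℂ) ^ 2 = (Real.sinh a : ℝ) ^ 2 + 1 := by
    exact_mod_cast Real.cosh_sq a
  have h2 : ((Real.cos b : ℝ) : ℂ) ^ 2 = 1 - (Real.sin b : ℝ) ^ 2 := by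
    exact_mod_cast Real.cos_sq' b
  push_cast at h1 h2 ⊢
  generalize Complex.sinh (a : ℂ) = S at *
  generalize Complex.cosh (a : ℂ) = C at *
  generalize Complex.sin (b : ℂ) = s at *
  generalize Complex.cos (b : ℂ) = c at *
  have hI : Complex.I ^ 2 = -1 := Complex.I_sq
  have key : (S * c + C * s * Complex.I) * (C * c + S * s * -Complex.I) =
      S * C + s * c * Complex.I := by
    linear_combination (-S * C * s ^ 2) * hI + S * C * h2 + s * c * Complex.I * h1
  have key2 : (S * C + s * c * Complex.I) * (a + b * -Complex.I) =
      (a * (S * C) + b * (s * c) + (a * (s * c) - b * (S * C)) * Complex.I) := by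
    linear_combination (-b * s * c) * hI
  rw [← key2, ← key]; ring

/-- For `b > 0` the imaginary part of `tanh z / z` is negative, because `sin 2b < 2b` and `sinh 2a >
2a`. The factor `I` carries the lower half plane to the right half plane, and nonzero real boundary
values of either sign to the imaginary axis, off the cut of the principal root. -/
lemma I_mul_tanh_div_mem_slitPlane {a b : ℝ} (ha : 0 < a) (hb : 0 ≤ b) :
    Complex.I * (Complex.tanh (a + b * Complex.I) / (a + b * Complex.I)) ∈ Complex.slitPlane := by
  have hs : 0 < Real.sinh a := Real.sinh_pos_iff.2 ha
  have hden : 0 < (Real.sinh a ^ 2 + Real.cos b ^ 2) * (a ^ 2 + b ^ 2) := by positivity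
  rw [tanh_div_eq, Complex.mem_slitPlane_iff]
  have hc := Real.one_lt_cosh.2 ha.ne'
  rcases hb.eq_or_lt with rfl | hb
  · right
    simp only [Complex.mul_im, Complex.I_re, Complex.I_im, Complex.div_ofReal_re]
    have : 0 < a * (Real.sinh a * Real.cosh a) := by positivity
    simp only [Complex.add_re, Complex.ofReal_re, Complex.mul_re, Complex.I_re, Complex.ofReal_im,
      Complex.I_im]
    have h4 : 0 < (Real.sinh a ^ 2 + Real.cos 0 ^ 2) * (a ^ 2 + 0 ^ 2) := hden
    simp only [mul_zero, zero_mul, add_zero, one_mul, zero_add, sub_zero]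
    positivity
  · left
    simp only [Complex.mul_re, Complex.I_re, Complex.I_im, Complex.div_ofReal_im]
    simp only [Complex.add_im, Complex.ofReal_re, Complex.mul_im, Complex.I_re, Complex.ofReal_im,
      Complex.I_im]
    have h1 : a < Real.sinh a * Real.cosh a := by
      have := Real.self_le_sinh_iff.2 ha.le
      nlinarith
    have h2 : Real.sin b * Real.cos b < b := by
      have h3 := Real.sin_lt (x := 2 * b) (by positivity)
      rw [Real.sin_two_mul] at h3
      linarith
    have h3 : a * (Real.sin b * Real.cos b) - b * (Real.sinh a * Real.cosh a) < 0 := by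
      have := mul_lt_mul_of_pos_left h2 ha
      have := mul_lt_mul_of_pos_left h1 hb
      linarith
    simp only [zero_mul, mul_zero, mul_one, add_zero, zero_add, zero_sub, one_mul]
    rw [neg_pos]
    exact div_neg_of_neg_of_pos h3 hden

/-- A branch of `√(tanh z / z)`, holomorphic on the open first quadrant and continuous up to its
boundary away from the zeros and poles of `tanh`. -/
def branch (z : ℂ) : ℂ :=
  (Complex.I * (Complex.tanh z / z)) ^ (1 / 2 : ℂ) / Complex.I ^ (1 / 2 : ℂ)

lemma differentiableAt_tanh {z : ℂ} (h : Complex.cosh z ≠ 0) :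
    DifferentiableAt ℂ Complex.tanh z := by
  have : Complex.tanh = fun z => Complex.sinh z / Complex.cosh z :=
    funext Complex.tanh_eq_sinh_div_cosh
  rw [this]
  exact Complex.differentiable_sinh.differentiableAt.div
    Complex.differentiable_cosh.differentiableAt h

lemma differentiableAt_branch {z : ℂ} (hc : Complex.cosh z ≠ 0) (h0 : z ≠ 0)
    (h : Complex.I * (Complex.tanh z / z) ∈ Complex.slitPlane) :
    DifferentiableAt ℂ branch z := by
  have h2 : DifferentiableAt ℂ (fun z => Complex.I * (Complex.tanh z / z)) z :=
    (differentiableAt_const _).mul ((differentiableAt_tanh hc).div differentiableAt_id h0)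
  exact (h2.cpow (differentiableAt_const _) h).div_const _

lemma differentiableAt_branch_of_pos {a b : ℝ} (ha : 0 < a) (hb : 0 ≤ b) :
    DifferentiableAt ℂ branch (a + b * Complex.I) :=
  differentiableAt_branch (cosh_add_mul_I_ne_zero (Or.inl ha.ne')) (add_mul_I_ne_zero (Or.inl ha.ne'))
    (I_mul_tanh_div_mem_slitPlane ha hb)

lemma norm_branch_sq (z : ℂ) : ‖branch z‖ ^ 2 = ‖Complex.tanh z / z‖ := by
  have h : branch z ^ 2 = Complex.tanh z / z := by
    unfold branch
    have key : ∀ w : ℂ, (w ^ (1 / 2 : ℂ)) ^ 2 = w := fun w => by simp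
    rw [div_pow, key, key]
    field_simp
  rw [← norm_pow, h]

lemma norm_tanh_sq (a b : ℝ) : ‖Complex.tanh (a + b * Complex.I)‖ ^ 2 =
    (Real.sinh a ^ 2 + Real.sin b ^ 2) / (Real.sinh a ^ 2 + Real.cos b ^ 2) := by
  rw [Complex.tanh_eq_sinh_div_cosh, norm_div, div_pow, ← Complex.normSq_eq_norm_sq,
    ← Complex.normSq_eq_norm_sq, normSq_sinh_add_mul_I, normSq_cosh_add_mul_I]

lemma norm_tanh_le_div_cos {a b : ℝ} (hb : Real.cos b ≠ 0) :
    ‖Complex.tanh (a + b * Complex.I)‖ ≤ Real.cosh a / |Real.cos b| := by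
  have hc := Real.cosh_pos a
  rw [← pow_le_pow_iff_left₀ (norm_nonneg _) (by positivity) two_ne_zero, norm_tanh_sq, div_pow,
    sq_abs, Real.cosh_sq]
  gcongr
  · exact Real.sin_sq_le_one b
  · nlinarith [sq_nonneg (Real.sinh a)]

lemma norm_tanh_le_two {a b : ℝ} (ha : 1 ≤ a) : ‖Complex.tanh (a + b * Complex.I)‖ ≤ 2 := by
  have h1 : 1 ≤ Real.sinh a := le_trans ha (Real.self_le_sinh_iff.2 (by linarith))
  rw [← pow_le_pow_iff_left₀ (norm_nonneg _) (by positivity) two_ne_zero, norm_tanh_sq,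
    div_le_iff₀ (by positivity)]
  nlinarith [Real.sin_sq_le_one b, sq_nonneg (Real.cos b)]

lemma le_norm_add_mul_I_re (a b : ℝ) : |a| ≤ ‖(a + b * Complex.I : ℂ)‖ := by
  simpa using Complex.abs_re_le_norm (a + b * Complex.I)

lemma le_norm_add_mul_I_im (a b : ℝ) : |b| ≤ ‖(a + b * Complex.I : ℂ)‖ := by
  simpa using Complex.abs_im_le_norm (a + b * Complex.I)

/-- Bound on the branch near the imaginary axis. -/
lemma norm_branch_le_cos {a b : ℝ} (ha : |a| ≤ 1) (hb : 0 < b) (hc : Real.cos b ≠ 0) :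
    ‖branch (a + b * Complex.I)‖ ≤ 2 / Real.sqrt (b * |Real.cos b|) := by
  rw [← pow_le_pow_iff_left₀ (norm_nonneg _) (by positivity) two_ne_zero, norm_branch_sq, norm_div,
    div_pow, Real.sq_sqrt (by positivity)]
  have h1 := norm_tanh_le_div_cos (a := a) hc
  have h2 := le_norm_add_mul_I_im a b
  rw [abs_of_pos hb] at h2
  have h3 : Real.cosh a ≤ 4 := by
    have : Real.cosh a ≤ Real.cosh 1 := Real.cosh_le_cosh.2 (by simpa using ha)
    have h4 : Real.cosh 1 ≤ 4 := by
      rw [Real.cosh_eq]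
      have := Real.exp_one_lt_d9
      have : Real.exp (-1) ≤ 1 := Real.exp_le_one_iff.2 (by norm_num)
      linarith
    linarith
  calc _ ≤ (Real.cosh a / |Real.cos b|) / b := by gcongr
    _ = Real.cosh a / (b * |Real.cos b|) := by rw [div_div, mul_comm]
    _ ≤ 2 ^ 2 / (b * |Real.cos b|) := by gcongr; linarith

/-- Bound on the branch away from the imaginary axis. -/
lemma norm_branch_le_re {a b : ℝ} (ha : 1 ≤ a) :
    ‖branch (a + b * Complex.I)‖ ≤ 2 / Real.sqrt a := by
  have ha' : 0 < a := by linarith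
  rw [← pow_le_pow_iff_left₀ (norm_nonneg _) (by positivity) two_ne_zero, norm_branch_sq, norm_div,
    div_pow, Real.sq_sqrt (by positivity)]
  have h2 := le_norm_add_mul_I_re a b
  rw [abs_of_pos ha'] at h2
  calc _ ≤ 2 / a := by gcongr; exact norm_tanh_le_two ha
    _ ≤ 2 ^ 2 / a := by gcongr; norm_num

lemma norm_branch_le_im {a b : ℝ} (ha : 1 ≤ a) (hb : 0 < b) :
    ‖branch (a + b * Complex.I)‖ ≤ 2 / Real.sqrt b := by
  rw [← pow_le_pow_iff_left₀ (norm_nonneg _) (by positivity) two_ne_zero, norm_branch_sq, norm_div,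
    div_pow, Real.sq_sqrt (by positivity)]
  have h2 := le_norm_add_mul_I_im a b
  rw [abs_of_pos hb] at h2
  calc _ ≤ 2 / b := by gcongr; exact norm_tanh_le_two ha
    _ ≤ 2 ^ 2 / b := by gcongr; norm_num

/-- Bound on the branch on the lines where `cos b = ±1`. -/
lemma norm_branch_le_of_sin_eq_zero {a b : ℝ} (hb : 0 < b) (hs : Real.sin b = 0) :
    ‖branch (a + b * Complex.I)‖ ≤ 1 / Real.sqrt b := by
  rw [← pow_le_pow_iff_left₀ (norm_nonneg _) (by positivity) two_ne_zero, norm_branch_sq, norm_div,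
    div_pow, Real.sq_sqrt (by positivity)]
  have h2 := le_norm_add_mul_I_im a b
  rw [abs_of_pos hb] at h2
  have h1 : ‖Complex.tanh (a + b * Complex.I)‖ ≤ 1 := by
    rw [← pow_le_pow_iff_left₀ (norm_nonneg _) (by positivity) two_ne_zero, norm_tanh_sq, hs]
    apply div_le_of_le_mul₀ (by positivity) (by norm_num)
    nlinarith [sq_nonneg (Real.cos b)]
  calc _ ≤ 1 / b := by gcongr
    _ = 1 ^ 2 / b := by norm_num

lemma I_cpow_half_ne_zero : Complex.I ^ (1 / 2 : ℂ) ≠ 0 := by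
  simp [Complex.cpow_eq_zero_iff]

lemma I_mul_ofReal_cpow_div {u : ℝ} (hu : 0 ≤ u) :
    (Complex.I * u) ^ (1 / 2 : ℂ) / Complex.I ^ (1 / 2 : ℂ) = Real.sqrt u := by
  have h : (Complex.I * u) ^ (1 / 2 : ℂ) = (u : ℂ) ^ (1 / 2 : ℂ) * Complex.I ^ (1 / 2 : ℂ) := by
    rcases hu.eq_or_lt with rfl | hu
    · simp
    rw [mul_comm, Complex.cpow_def_of_ne_zero (by simp [hu.ne']),
      Complex.cpow_def_of_ne_zero (by simp [hu.ne']), Complex.cpow_def_of_ne_zero (by simp),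
      Complex.log_ofReal_mul hu (by simp), ← Complex.exp_add, Complex.ofReal_log hu.le]
    ring_nf
  rw [h, mul_div_assoc, div_self I_cpow_half_ne_zero, mul_one, Real.sqrt_eq_rpow,
    Complex.ofReal_cpow hu]
  norm_num

/-- The sign `-I` is that of the limit from the lower half plane; it is what makes the representing
density nonnegative rather than nonpositive. -/
lemma I_mul_neg_ofReal_cpow_div {u : ℝ} (hu : 0 < u) :
    (Complex.I * ((-u : ℝ) : ℂ)) ^ (1 / 2 : ℂ) / Complex.I ^ (1 / 2 : ℂ) =
      -Complex.I * Real.sqrt u := by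
  have h : (Complex.I * ((-u : ℝ) : ℂ)) ^ (1 / 2 : ℂ) =
      (u : ℂ) ^ (1 / 2 : ℂ) * (-Complex.I) * Complex.I ^ (1 / 2 : ℂ) := by
    have e : Complex.I * ((-u : ℝ) : ℂ) = (u : ℂ) * (-Complex.I) := by push_cast; ring
    have e2 : (-Complex.I : ℂ) = Complex.exp (Complex.log (-Complex.I)) := by
      rw [Complex.exp_log (by simp)]
    rw [e, Complex.cpow_def_of_ne_zero (by simp [hu.ne']),
      Complex.cpow_def_of_ne_zero (by simp [hu.ne']), Complex.cpow_def_of_ne_zero (by simp),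
      Complex.log_ofReal_mul hu (by simp), Complex.ofReal_log hu.le]
    conv_rhs => rw [e2]
    rw [← Complex.exp_add, ← Complex.exp_add, Complex.log_neg_I, Complex.log_I]
    ring_nf
  rw [h, mul_div_assoc, div_self I_cpow_half_ne_zero, mul_one, Real.sqrt_eq_rpow,
    Complex.ofReal_cpow hu.le]
  norm_num [mul_comm]

lemma branch_ofReal {ξ : ℝ} (h : 0 < ξ) : branch ξ = symbol ξ := by
  have h1 : 0 ≤ Real.tanh ξ / ξ := by
    rw [Real.tanh_eq_sinh_div_cosh]
    have := Real.sinh_pos_iff.2 h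
    positivity
  rw [branch, symbol, if_neg h.ne', ← I_mul_ofReal_cpow_div h1]
  push_cast; rfl

/-- The density `√(-tan s / s)` of the representing measure of the kernel, up to the factor `π`;
it vanishes where `tan` is positive. -/
def cutDensity (s : ℝ) : ℝ := Real.sqrt (-(Real.tan s / s))

lemma branch_mul_I (s : ℝ) : (Complex.I * branch (s * Complex.I)).re = cutDensity s := by
  have h1 : Complex.tanh (s * Complex.I) / (s * Complex.I) = ((Real.tan s / s : ℝ) : ℂ) := by
    rw [Complex.tanh_mul_I, mul_div_mul_right _ _ Complex.I_ne_zero]; push_cast; rfl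
  rw [branch, h1, cutDensity]
  rcases le_or_gt 0 (Real.tan s / s) with h | h
  · rw [I_mul_ofReal_cpow_div h, Real.sqrt_eq_zero_of_nonpos (neg_nonpos.2 h)]
    simp
  · have := I_mul_neg_ofReal_cpow_div (u := -(Real.tan s / s)) (neg_pos.2 h)
    rw [neg_neg] at this
    rw [this]
    simp

lemma branch_continuousAt_mul_I {s : ℝ} (hs : 0 < s) (hsin : Real.sin s ≠ 0)
    (hcos : Real.cos s ≠ 0) : ContinuousAt branch (s * Complex.I) := by
  have hc : Complex.cosh (s * Complex.I) ≠ 0 := by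
    simpa using cosh_add_mul_I_ne_zero (a := 0) (b := s) (Or.inr hcos)
  refine (differentiableAt_branch hc (by simp [hs.ne']) ?_).continuousAt
  have h1 : Complex.tanh (s * Complex.I) / (s * Complex.I) = ((Real.tan s / s : ℝ) : ℂ) := by
    rw [Complex.tanh_mul_I, mul_div_mul_right _ _ Complex.I_ne_zero]; push_cast; rfl
  rw [h1, Complex.mem_slitPlane_iff]
  right
  have : Real.tan s ≠ 0 := by rw [Real.tan_eq_sin_div_cos]; positivity
  rw [Complex.mul_im, Complex.ofReal_re, Complex.ofReal_im]
  simpa using ⟨this, hs.ne'⟩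

/-! ### An integrable majorant -/

lemma intervalIntegrable_one_div_sqrt_abs_sin :
    IntervalIntegrable (fun x => 1 / Real.sqrt |Real.sin x|) volume 0 (Real.pi / 2) := by
  have hpi := Real.pi_pos
  have h : IntervalIntegrable (fun x : ℝ => Real.sqrt (Real.pi / 2) * x ^ (-(1 / 2) : ℝ)) volume 0
      (Real.pi / 2) := (intervalIntegral.intervalIntegrable_rpow' (by norm_num)).const_mul _
  refine h.mono_fun (Measurable.aestronglyMeasurable (by fun_prop)) ?_
  rw [uIoc_of_le (by positivity)]
  refine (ae_restrict_iff' measurableSet_Ioc).2 (.of_forall fun x hx => ?_)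
  have hx0 : 0 < x := hx.1
  have h1 := Real.mul_le_sin hx.1.le hx.2
  have h2 : 0 < 2 / Real.pi * x := by positivity
  dsimp only
  rw [Real.norm_of_nonneg (by positivity), Real.norm_of_nonneg (by positivity),
    Real.rpow_neg hx.1.le, ← Real.sqrt_eq_rpow, abs_of_pos (by linarith)]
  calc 1 / Real.sqrt (Real.sin x) ≤ 1 / Real.sqrt (2 / Real.pi * x) := by gcongr
    _ = _ := by
      rw [Real.sqrt_mul (by positivity), one_div, mul_inv, ← Real.sqrt_inv, inv_div]

lemma intervalIntegrable_one_div_sqrt_abs_cos (a b : ℝ) :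
    IntervalIntegrable (fun x => 1 / Real.sqrt |Real.cos x|) volume a b := by
  have h1 := intervalIntegrable_one_div_sqrt_abs_sin
  have h2 := (h1.comp_sub_left Real.pi).symm
  simp only [Real.sin_pi_sub, sub_zero] at h2
  rw [sub_half] at h2
  have h3 := h1.trans h2
  have hper : Function.Periodic (fun x => 1 / Real.sqrt |Real.sin x|) Real.pi := fun x => by
    simp [Real.sin_add_pi]
  have h4 := hper.intervalIntegrable (t := 0) Real.pi_ne_zero (by simpa using h3)
    (a + Real.pi / 2) (b + Real.pi / 2)
  have h5 := h4.comp_add_right (Real.pi / 2)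
  simpa [Real.sin_add_pi_div_two] using h5

/-- An integrable majorant for the symbol on vertical lines. -/
def majorant (s : ℝ) : ℝ := 1 / ((1 + s) * Real.sqrt (s * |Real.cos s|))

lemma measurable_majorant : Measurable majorant := by unfold majorant; fun_prop

lemma majorant_nonneg {s : ℝ} (hs : 0 < s) : 0 ≤ majorant s := by unfold majorant; positivity

lemma integrableOn_majorant_Ioc : IntegrableOn majorant (Ioc 0 1) := by
  have h : IntegrableOn (fun x : ℝ => Real.sqrt 2 * x ^ (-(1 / 2) : ℝ)) (Ioc 0 1) :=
    (intervalIntegrable_iff_integrableOn_Ioc_of_le zero_le_one).1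
      ((intervalIntegral.intervalIntegrable_rpow' (by norm_num)).const_mul _)
  refine h.mono' measurable_majorant.aestronglyMeasurable ?_
  refine (ae_restrict_iff' measurableSet_Ioc).2 (.of_forall fun x hx => ?_)
  have hx0 : 0 < x := hx.1
  have h1 : 1 / 2 ≤ Real.cos x := by
    have := Real.one_sub_sq_div_two_le_cos (x := x)
    nlinarith [hx.2]
  rw [Real.norm_of_nonneg (majorant_nonneg hx0), Real.rpow_neg hx.1.le, ← Real.sqrt_eq_rpow,
    majorant, abs_of_pos (by linarith)]
  calc 1 / ((1 + x) * Real.sqrt (x * Real.cos x)) ≤ 1 / (1 * Real.sqrt (x * (1 / 2))) := by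
        gcongr
        linarith
    _ = _ := by
      rw [Real.sqrt_mul hx0.le, one_mul, one_div, mul_inv, ← Real.sqrt_inv (1 / 2), mul_comm]
      norm_num

lemma integrableOn_majorant : IntegrableOn majorant (Ioi 0) := by
  have hpi := Real.pi_gt_three
  -- Each `A n` is one period of `|cos|`, so `1 / √|cos|` has the same integral on all of them,
  -- while the other factors of the majorant contribute the summable `(n+1)^(-3/2)`. Starting at `1`
  -- avoids the singularity at `0`.
  set A : ℕ → Set ℝ := fun n => Ioc (1 + n * Real.pi) (1 + (n + 1) * Real.pi) with hA
  have hp : ∀ n : ℕ, IntegrableOn (fun x => 1 / Real.sqrt |Real.cos x|) (A n) := fun n =>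
    (intervalIntegrable_iff_integrableOn_Ioc_of_le (by nlinarith)).1
      (intervalIntegrable_one_div_sqrt_abs_cos _ _)
  have hbd : ∀ n : ℕ, ∀ x ∈ A n, ‖majorant x‖ ≤
      1 / ((n + 1 : ℝ) ^ (3 / 2 : ℝ)) * (1 / Real.sqrt |Real.cos x|) := by
    intro n x hx
    have hn : (0 : ℝ) ≤ n := by positivity
    have hx1 : (n + 1 : ℝ) ≤ x := by nlinarith [hx.1]
    have hx0 : 0 < x := by linarith
    rw [Real.norm_of_nonneg (majorant_nonneg hx0), majorant, Real.sqrt_mul hx0.le, ← mul_assoc,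
      one_div_mul_one_div]
    have h3 : (n + 1 : ℝ) ^ (3 / 2 : ℝ) = (n + 1) * Real.sqrt (n + 1) := by
      rw [Real.sqrt_eq_rpow, ← Real.rpow_one_add' (by positivity) (by norm_num)]; norm_num
    by_cases hc : Real.cos x = 0
    · simp [hc]
    rw [h3]
    have : 0 < |Real.cos x| := abs_pos.2 hc
    have h4 : (n + 1 : ℝ) ≤ 1 + x := by linarith
    gcongr
  have hI : ∀ n, IntegrableOn majorant (A n) := fun n =>
    ((hp n).const_mul (1 / ((n + 1 : ℝ) ^ (3 / 2 : ℝ)))).mono'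
      measurable_majorant.aestronglyMeasurable
      ((ae_restrict_iff' measurableSet_Ioc).2 (.of_forall (hbd n)))
  have hper : Function.Periodic (fun x => 1 / Real.sqrt |Real.cos x|) Real.pi := fun x => by
    simp [Real.cos_add_pi]
  have hconst : ∀ n, ∫ x in A n, 1 / Real.sqrt |Real.cos x| =
      ∫ x in 0..Real.pi, 1 / Real.sqrt |Real.cos x| := fun n => by
    rw [← intervalIntegral.integral_of_le (by nlinarith)]
    have := hper.intervalIntegral_add_eq (1 + n * Real.pi) 0
    rw [zero_add] at this
    rw [← this]; ring_nf
  have hU : IntegrableOn majorant (⋃ n, A n) := by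
    refine integrableOn_iUnion_of_summable_integral_norm hI ?_
    have hs : Summable fun n : ℕ => 1 / ((n + 1 : ℝ) ^ (3 / 2 : ℝ)) *
        ∫ x in 0..Real.pi, 1 / Real.sqrt |Real.cos x| := by
      apply Summable.mul_right
      have := (summable_nat_add_iff 1).2
        (Real.summable_one_div_nat_rpow.2 (by norm_num : (1 : ℝ) < 3 / 2))
      simpa using this
    refine Summable.of_nonneg_of_le (fun n => integral_nonneg fun _ => norm_nonneg _) (fun n => ?_) hs
    rw [← hconst n, ← integral_const_mul]
    exact setIntegral_mono_on (hI n).norm ((hp n).const_mul _) measurableSet_Ioc (hbd n)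
  refine (integrableOn_majorant_Ioc.union hU).mono_set fun x hx => ?_
  by_cases h1 : x ≤ 1
  · exact Or.inl ⟨hx, h1⟩
  · right
    have hx1 : 0 < (x - 1) / Real.pi := div_pos (by linarith) (by linarith)
    obtain ⟨n, hn⟩ : ∃ n : ℕ, ⌈(x - 1) / Real.pi⌉₊ = n + 1 :=
      Nat.exists_eq_succ_of_ne_zero (Nat.ceil_pos.2 hx1).ne'
    have h2 := Nat.le_ceil ((x - 1) / Real.pi)
    have h3 := Nat.ceil_lt_add_one hx1.le
    rw [hn] at h2 h3
    push_cast at h2 h3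
    rw [div_le_iff₀ (by linarith)] at h2
    have h4 : (n : ℝ) < (x - 1) / Real.pi := by linarith
    rw [lt_div_iff₀ (by linarith)] at h4
    exact mem_iUnion.2 ⟨n, by linarith, by linarith⟩

lemma ae_sin_ne_zero_and_cos_ne_zero : ∀ᵐ s : ℝ, Real.sin s ≠ 0 ∧ Real.cos s ≠ 0 := by
  have h : {s : ℝ | ¬ (Real.sin s ≠ 0 ∧ Real.cos s ≠ 0)} ⊆
      range fun n : ℤ => n * (Real.pi / 2) := by
    intro s hs
    have h2 : Real.sin (2 * s) = 0 := by
      rw [Real.sin_two_mul]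
      by_contra h
      exact hs ⟨fun h' => h (by simp [h']), fun h' => h (by simp [h'])⟩
    obtain ⟨n, hn⟩ := Real.sin_eq_zero_iff.1 h2
    exact ⟨n, by dsimp only; linarith⟩
  exact measure_mono_null h ((countable_range _).measure_zero volume)

/-! ### The symbol -/

lemma hasDerivAt_tanh_zero : HasDerivAt Real.tanh 1 0 := by
  have h : Real.tanh = fun x => Real.sinh x / Real.cosh x := funext Real.tanh_eq_sinh_div_cosh
  rw [h]
  exact ((Real.hasDerivAt_sinh 0).div (Real.hasDerivAt_cosh 0) (Real.cosh_pos 0).ne').congr_deriv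
    (by simp)

lemma continuous_tanh : Continuous Real.tanh := by
  have h : Real.tanh = fun x => Real.sinh x / Real.cosh x := funext Real.tanh_eq_sinh_div_cosh
  rw [h]
  exact Real.continuous_sinh.div Real.continuous_cosh fun x => (Real.cosh_pos x).ne'

lemma continuous_symbol : Continuous symbol := by
  have h : symbol = fun ξ => Real.sqrt (dslope Real.tanh 0 ξ) := by
    funext ξ
    by_cases h0 : ξ = 0
    · simp [symbol, h0, hasDerivAt_tanh_zero.deriv]
    · simp [symbol, h0, dslope_of_ne, slope_def_field]
  rw [h]
  refine Real.continuous_sqrt.comp (continuous_iff_continuousAt.2 fun ξ => ?_)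
  by_cases h0 : ξ = 0
  · rw [h0]; exact continuousAt_dslope_same.2 hasDerivAt_tanh_zero.differentiableAt
  · exact (continuousAt_dslope_of_ne h0).2 continuous_tanh.continuousAt

lemma symbol_neg (ξ : ℝ) : symbol (-ξ) = symbol ξ := by simp [symbol, neg_div_neg_eq]

lemma symbol_nonneg (ξ : ℝ) : 0 ≤ symbol ξ := by
  unfold symbol; split_ifs <;> positivity

lemma symbol_le_one {ξ : ℝ} (h : 0 < ξ) : symbol ξ ≤ 1 := by
  rw [symbol, if_neg h.ne', Real.sqrt_le_one]
  rw [div_le_one h, Real.tanh_eq_sinh_div_cosh, div_le_iff₀ (Real.cosh_pos _)]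
  have hm : MonotoneOn (fun x => x * Real.cosh x - Real.sinh x) (Ici 0) := by
    refine monotoneOn_of_hasDerivWithinAt_nonneg (f' := fun x => x * Real.sinh x) (convex_Ici 0)
      (by fun_prop) (fun x hx => ?_) fun x hx => ?_
    · have := ((hasDerivAt_id x).mul (Real.hasDerivAt_cosh x)).sub (Real.hasDerivAt_sinh x)
      refine (this.congr_deriv ?_).hasDerivWithinAt
      simp
    · rw [interior_Ici] at hx
      have := Real.sinh_pos_iff.2 hx
      exact mul_nonneg (le_of_lt hx) this.le
  have := hm self_mem_Ici h.le h.le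
  simp at this
  linarith

/-! ### The contour integral -/

section Contour

variable {g : ℂ → ℂ} {C : ℝ}

lemma norm_branch_mul_le
    (hb : ∀ a b : ℝ, 0 ≤ a → 0 ≤ b → ‖g (a + b * Complex.I)‖ ≤ C / (1 + b))
    {a b : ℝ} (ha : 0 ≤ a) (hb0 : 0 < b) (hc : Real.cos b ≠ 0) :
    ‖branch (a + b * Complex.I) * g (a + b * Complex.I)‖ ≤ 2 * C * majorant b := by
  have hc' : 0 < |Real.cos b| := abs_pos.2 hc
  have h1 : ‖branch (a + b * Complex.I)‖ ≤ 2 / Real.sqrt (b * |Real.cos b|) := by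
    rcases le_total a 1 with h | h
    · exact norm_branch_le_cos (by rwa [abs_of_nonneg ha]) hb0 hc
    · refine (norm_branch_le_im h hb0).trans ?_
      gcongr
      exact mul_le_of_le_one_right hb0.le (Real.abs_cos_le_one b)
  rw [norm_mul]
  calc _ ≤ 2 / Real.sqrt (b * |Real.cos b|) * (C / (1 + b)) := by
        gcongr; exact hb a b ha hb0.le
    _ = _ := by rw [majorant]; field_simp

lemma continuousOn_vertical
    (hg : ∀ a b : ℝ, 0 ≤ a → 0 ≤ b → DifferentiableAt ℂ g (a + b * Complex.I))
    {a : ℝ} (ha : 0 < a) :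
    ContinuousOn (fun b : ℝ => branch (a + b * Complex.I) * g (a + b * Complex.I)) (Ici 0) := by
  intro b hb
  have h1 := (differentiableAt_branch_of_pos ha hb).continuousAt
  have h2 := (hg a b ha.le hb).continuousAt
  have h3 : ContinuousAt (fun b : ℝ => (a + b * Complex.I : ℂ)) b := by fun_prop
  exact ((h1.comp_of_eq h3 rfl).mul (h2.comp_of_eq h3 rfl)).continuousWithinAt

lemma integrableOn_vertical
    (hg : ∀ a b : ℝ, 0 ≤ a → 0 ≤ b → DifferentiableAt ℂ g (a + b * Complex.I))
    (hb : ∀ a b : ℝ, 0 ≤ a → 0 ≤ b → ‖g (a + b * Complex.I)‖ ≤ C / (1 + b))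
    {a : ℝ} (ha : 0 < a) :
    IntegrableOn (fun b : ℝ => branch (a + b * Complex.I) * g (a + b * Complex.I)) (Ioi 0) := by
  refine (integrableOn_majorant.const_mul (2 * C)).mono'
    (((continuousOn_vertical hg ha).mono Ioi_subset_Ici_self).aestronglyMeasurable
      measurableSet_Ioi) ?_
  refine (ae_restrict_iff' measurableSet_Ioi).2 ?_
  filter_upwards [ae_sin_ne_zero_and_cos_ne_zero] with b h hb0
  exact norm_branch_mul_le hb ha.le hb0 h.2

/-- Cauchy's theorem on the rectangles `[ε, R] × [0, nπ]`. The poles of `tanh` have imaginary parts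
in `π/2 + πℤ`; at the heights `nπ` one has `|tanh| ≤ 1`, so the top edge vanishes as `n → ∞`. -/
lemma integral_horizontal_eq
    (hg : ∀ a b : ℝ, 0 ≤ a → 0 ≤ b → DifferentiableAt ℂ g (a + b * Complex.I))
    (hb : ∀ a b : ℝ, 0 ≤ a → 0 ≤ b → ‖g (a + b * Complex.I)‖ ≤ C / (1 + b))
    {ε R : ℝ} (hε : 0 < ε) (hR : ε ≤ R) :
    ∫ ξ in ε..R, branch ξ * g ξ =
      Complex.I * (∫ b in Ioi (0 : ℝ), branch (ε + b * Complex.I) * g (ε + b * Complex.I)) -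
      Complex.I * (∫ b in Ioi (0 : ℝ), branch (R + b * Complex.I) * g (R + b * Complex.I)) := by
  have hR0 : 0 < R := by linarith
  have hC : 0 ≤ C := by
    have := (norm_nonneg _).trans (hb 0 0 le_rfl le_rfl)
    simpa using this
  set F : ℂ → ℂ := fun z => branch z * g z with hF
  have hrect : ∀ n : ℕ, ((∫ x : ℝ in ε..R, F x) -
      ∫ x : ℝ in ε..R, F (x + ((n * Real.pi : ℝ) : ℂ) * Complex.I)) +
      Complex.I * (∫ y : ℝ in 0..(n * Real.pi), F (R + y * Complex.I)) -
      Complex.I * (∫ y : ℝ in 0..(n * Real.pi), F (ε + y * Complex.I)) = 0 := by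
    intro n
    have hn : 0 ≤ n * Real.pi := by positivity
    have := Complex.integral_boundary_rect_eq_zero_of_differentiableOn F
      (⟨ε, 0⟩ : ℂ) (⟨R, n * Real.pi⟩ : ℂ) ?_
    · simpa using this
    · rintro z ⟨hz1, hz2⟩
      simp only [uIcc_of_le hR, uIcc_of_le hn, mem_preimage, mem_Icc] at hz1 hz2
      rw [← Complex.re_add_im z]
      exact ((differentiableAt_branch_of_pos (by linarith) hz2.1).mul
        (hg z.re z.im (by linarith) hz2.1)).differentiableWithinAt
  have hT : Tendsto (fun n : ℕ => (n : ℝ) * Real.pi) atTop atTop :=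
    tendsto_natCast_atTop_atTop.atTop_mul_const Real.pi_pos
  have hv : ∀ a : ℝ, 0 < a → Tendsto (fun n : ℕ => ∫ y : ℝ in 0..(n * Real.pi),
      F (a + y * Complex.I)) atTop (𝓝 (∫ y in Ioi (0 : ℝ), F (a + y * Complex.I))) := fun a ha =>
    intervalIntegral_tendsto_integral_Ioi 0 (integrableOn_vertical hg hb ha) hT
  have htop : Tendsto (fun n : ℕ => ∫ x : ℝ in ε..R,
      F (x + ((n * Real.pi : ℝ) : ℂ) * Complex.I)) atTop (𝓝 0) := by
    have h0 : Tendsto (fun n : ℕ => C / (1 + n * Real.pi) * |R - ε|) atTop (𝓝 0) := by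
      have : Tendsto (fun n : ℕ => C / (1 + n * Real.pi)) atTop (𝓝 0) :=
        Tendsto.const_div_atTop (tendsto_atTop_add_const_left _ _ hT) _
      simpa using this.mul_const |R - ε|
    refine squeeze_zero_norm' ?_ h0
    filter_upwards [eventually_ge_atTop 1] with n hn
    have hn1 : 1 ≤ (n : ℝ) * Real.pi := by
      have : (1 : ℝ) ≤ n := by exact_mod_cast hn
      nlinarith [Real.pi_gt_three]
    refine intervalIntegral.norm_integral_le_of_norm_le_const fun x hx => ?_
    rw [uIoc_of_le hR] at hx
    rw [hF, norm_mul]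
    have h1 := norm_branch_le_of_sin_eq_zero (a := x) (b := n * Real.pi) (by linarith)
      (Real.sin_nat_mul_pi n)
    have h2 : 1 / Real.sqrt (n * Real.pi) ≤ 1 := by
      rw [div_le_one (Real.sqrt_pos.2 (by linarith))]
      exact Real.one_le_sqrt.2 hn1
    calc _ ≤ 1 * (C / (1 + n * Real.pi)) := by
          gcongr
          · exact h1.trans h2
          · exact hb x _ (by linarith [hx.1]) (by linarith)
      _ = _ := one_mul _
  have hlim := ((tendsto_const_nhds (x := ∫ x : ℝ in ε..R, F x)).sub htop).add
    ((hv R hR0).const_mul Complex.I) |>.sub ((hv ε hε).const_mul Complex.I)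
  have := tendsto_nhds_unique hlim ((tendsto_const_nhds (x := (0 : ℂ))).congr fun n => (hrect n).symm)
  linear_combination this

/-- In the contour identity let `ε → 0` and `R → ∞`, both by dominated convergence with `majorant`:
the left edge tends to the imaginary axis and the right edge to zero. As `g` is real on the positive
imaginary axis, only `Re (I * branch)`, that is `cutDensity`, survives there. -/
lemma tendsto_integral_symbol_mul
    (hg : ∀ a b : ℝ, 0 ≤ a → 0 ≤ b → DifferentiableAt ℂ g (a + b * Complex.I))
    (hb : ∀ a b : ℝ, 0 ≤ a → 0 ≤ b → ‖g (a + b * Complex.I)‖ ≤ C / (1 + b))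
    (him : ∀ b : ℝ, 0 < b → (g (b * Complex.I)).im = 0) :
    Tendsto (fun R : ℝ => ∫ ξ in 0..R, symbol ξ * (g ξ).re) atTop
      (𝓝 (∫ s in Ioi (0 : ℝ), cutDensity s * (g (s * Complex.I)).re)) := by
  have hC : 0 ≤ C := by
    have := (norm_nonneg _).trans (hb 0 0 le_rfl le_rfl)
    simpa using this
  set Φ : ℝ → ℂ := fun a => ∫ b in Ioi (0 : ℝ), branch (a + b * Complex.I) * g (a + b * Complex.I)
    with hΦ
  have hmaj := integrableOn_majorant.const_mul (2 * C)
  have hmeas : ∀ a : ℝ, 0 < a → AEStronglyMeasurable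
      (fun b : ℝ => branch (a + b * Complex.I) * g (a + b * Complex.I))
      (volume.restrict (Ioi 0)) := fun a ha =>
    ((continuousOn_vertical hg ha).mono Ioi_subset_Ici_self).aestronglyMeasurable measurableSet_Ioi
  have hdom : ∀ a : ℝ, 0 < a → ∀ᵐ b : ℝ ∂(volume.restrict (Ioi 0)),
      ‖branch (a + b * Complex.I) * g (a + b * Complex.I)‖ ≤ 2 * C * majorant b := fun a ha => by
    refine (ae_restrict_iff' measurableSet_Ioi).2 ?_
    filter_upwards [ae_sin_ne_zero_and_cos_ne_zero] with b h hb0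
    exact norm_branch_mul_le hb ha.le hb0 h.2
  have hzero : Tendsto Φ (𝓝[>] 0)
      (𝓝 (∫ b in Ioi (0 : ℝ), branch (b * Complex.I) * g (b * Complex.I))) := by
    refine tendsto_integral_filter_of_dominated_convergence _
      (eventually_mem_nhdsWithin.mono fun a ha => hmeas a ha)
      (eventually_mem_nhdsWithin.mono fun a ha => hdom a ha) hmaj ?_
    refine (ae_restrict_iff' measurableSet_Ioi).2 ?_
    filter_upwards [ae_sin_ne_zero_and_cos_ne_zero] with b h hb0
    have h1 := branch_continuousAt_mul_I hb0 h.1 h.2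
    have h2 : ContinuousAt g (b * Complex.I) := by
      simpa using (hg 0 b le_rfl (le_of_lt hb0)).continuousAt
    have h3 : Tendsto (fun a : ℝ => (a + b * Complex.I : ℂ)) (𝓝[>] 0) (𝓝 (b * Complex.I)) := by
      have : ContinuousAt (fun a : ℝ => (a + b * Complex.I : ℂ)) 0 := by fun_prop
      have := this.tendsto.mono_left (nhdsWithin_le_nhds (s := Ioi 0))
      simpa using this
    exact (h1.tendsto.comp h3).mul (h2.tendsto.comp h3)
  have hinf : Tendsto Φ atTop (𝓝 0) := by
    have : Tendsto Φ atTop (𝓝 (∫ b in Ioi (0 : ℝ), (0 : ℂ))) := by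
      refine tendsto_integral_filter_of_dominated_convergence _
        ((eventually_gt_atTop 0).mono fun a ha => hmeas a ha)
        ((eventually_gt_atTop 0).mono fun a ha => hdom a ha) hmaj ?_
      refine (ae_restrict_iff' measurableSet_Ioi).2 (.of_forall fun b hb0 => ?_)
      have h0 : Tendsto (fun a : ℝ => 2 / Real.sqrt a * C) atTop (𝓝 0) := by
        have : Tendsto (fun a : ℝ => 2 / Real.sqrt a) atTop (𝓝 0) :=
          Tendsto.const_div_atTop Real.tendsto_sqrt_atTop _
        simpa using this.mul_const C
      refine squeeze_zero_norm' ?_ h0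
      filter_upwards [eventually_ge_atTop 1] with a ha
      rw [norm_mul]
      have h1 : ‖g (a + b * Complex.I)‖ ≤ C :=
        (hb a b (by linarith) (le_of_lt hb0)).trans
          (div_le_self hC (by linarith [mem_Ioi.1 hb0]))
      have h2 := norm_branch_le_re (b := b) ha
      gcongr
    simpa using this
  have hcont : ∀ R : ℝ, 0 < R → ContinuousOn (fun ξ : ℝ => symbol ξ * (g ξ).re) (Icc 0 R) := by
    intro R hR ξ hξ
    have h2 : ContinuousAt g (ξ : ℂ) := by
      simpa using (hg ξ 0 hξ.1 le_rfl).continuousAt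
    have h3 : ContinuousAt (fun ξ : ℝ => (g ξ).re) ξ :=
      Complex.continuous_re.continuousAt.comp
        (h2.comp_of_eq (Complex.continuous_ofReal.continuousAt (x := ξ)) rfl)
    exact (continuous_symbol.continuousAt.mul h3).continuousWithinAt
  have hfin : ∀ R : ℝ, 0 < R → ∫ ξ in 0..R, symbol ξ * (g ξ).re =
      (Complex.I * ∫ b in Ioi (0 : ℝ), branch (b * Complex.I) * g (b * Complex.I)).re -
        (Complex.I * Φ R).re := by
    intro R hR
    have hl : Tendsto (fun ε : ℝ => ∫ ξ in ε..R, symbol ξ * (g ξ).re) (𝓝[>] 0)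
        (𝓝 (∫ ξ in 0..R, symbol ξ * (g ξ).re)) := by
      have hi : IntegrableOn (fun ξ : ℝ => symbol ξ * (g ξ).re) (uIcc 0 R) := by
        rw [uIcc_of_le hR.le]; exact (hcont R hR).integrableOn_Icc
      have := intervalIntegral.continuousOn_primitive_interval_left hi 0 left_mem_uIcc
      rw [uIcc_of_le hR.le] at this
      refine this.tendsto.mono_left ?_
      rw [← nhdsWithin_Ioo_eq_nhdsGT hR]
      exact nhdsWithin_mono _ Ioo_subset_Icc_self
    have hr : Tendsto (fun ε : ℝ => (Complex.I * Φ ε).re - (Complex.I * Φ R).re) (𝓝[>] 0)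
        (𝓝 ((Complex.I * ∫ b in Ioi (0 : ℝ), branch (b * Complex.I) * g (b * Complex.I)).re -
        (Complex.I * Φ R).re)) :=
      ((Complex.continuous_re.tendsto _).comp (hzero.const_mul Complex.I)).sub_const _
    refine tendsto_nhds_unique hl (hr.congr' ?_)
    filter_upwards [Ioo_mem_nhdsGT hR] with ε hε
    have h1 := integral_horizontal_eq hg hb hε.1 hε.2.le
    rw [← Complex.sub_re, ← h1]
    have hii : IntervalIntegrable (fun ξ : ℝ => branch ξ * g ξ) volume ε R := by
      refine ContinuousOn.intervalIntegrable fun ξ hξ => ?_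
      rw [uIcc_of_le hε.2.le] at hξ
      have hξ0 : 0 < ξ := lt_of_lt_of_le hε.1 hξ.1
      have h2 : ContinuousAt g (ξ : ℂ) := by
        simpa using (hg ξ 0 hξ0.le le_rfl).continuousAt
      have h3 : ContinuousAt branch (ξ : ℂ) := by
        simpa using (differentiableAt_branch_of_pos hξ0 (le_refl 0)).continuousAt
      have h4 := Complex.continuous_ofReal.continuousAt (x := ξ)
      exact ((h3.comp_of_eq h4 rfl).mul (h2.comp_of_eq h4 rfl)).continuousWithinAt
    have h2 := Complex.reCLM.intervalIntegral_comp_comm hii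
    rw [Complex.reCLM_apply] at h2
    rw [← h2]
    refine intervalIntegral.integral_congr fun ξ hξ => ?_
    rw [uIcc_of_le hε.2.le] at hξ
    simp [branch_ofReal (lt_of_lt_of_le hε.1 hξ.1)]
  have hval : (Complex.I * ∫ b in Ioi (0 : ℝ), branch (b * Complex.I) * g (b * Complex.I)).re =
      ∫ s in Ioi (0 : ℝ), cutDensity s * (g (s * Complex.I)).re := by
    have hint : IntegrableOn (fun b : ℝ => Complex.I * (branch (b * Complex.I) * g (b * Complex.I)))
        (Ioi 0) := by
      refine Integrable.const_mul ?_ _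
      refine hmaj.mono' (aestronglyMeasurable_of_tendsto_ae (𝓝[>] (0 : ℝ))
        (f := fun (a : ℝ) (b : ℝ) => if 0 < a then
          branch (a + b * Complex.I) * g (a + b * Complex.I) else 0) (fun a => ?_) ?_) ?_
      · by_cases ha : 0 < a
        · simpa [ha] using hmeas a ha
        · simp [ha, aestronglyMeasurable_const]
      · refine (ae_restrict_iff' measurableSet_Ioi).2 ?_
        filter_upwards [ae_sin_ne_zero_and_cos_ne_zero] with b h hb0
        have h1 := branch_continuousAt_mul_I hb0 h.1 h.2
        have h2 : ContinuousAt g (b * Complex.I) := by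
          simpa using (hg 0 b le_rfl (le_of_lt hb0)).continuousAt
        have h3 : Tendsto (fun a : ℝ => (a + b * Complex.I : ℂ)) (𝓝[>] 0) (𝓝 (b * Complex.I)) := by
          have : ContinuousAt (fun a : ℝ => (a + b * Complex.I : ℂ)) 0 := by fun_prop
          have := this.tendsto.mono_left (nhdsWithin_le_nhds (s := Ioi 0))
          simpa using this
        refine ((h1.tendsto.comp h3).mul (h2.tendsto.comp h3)).congr' ?_
        filter_upwards [eventually_mem_nhdsWithin] with a ha
        simp [mem_Ioi.1 ha]
      · refine (ae_restrict_iff' measurableSet_Ioi).2 ?_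
        filter_upwards [ae_sin_ne_zero_and_cos_ne_zero] with b h hb0
        simpa using norm_branch_mul_le hb le_rfl hb0 h.2
    rw [← integral_const_mul, ← Complex.reCLM_apply, ← Complex.reCLM.integral_comp_comm hint]
    refine setIntegral_congr_fun measurableSet_Ioi fun b hb0 => ?_
    rw [Complex.reCLM_apply, ← mul_assoc, Complex.mul_re, him b hb0, branch_mul_I]
    ring
  have hlast : Tendsto (fun R => (Complex.I * ∫ b in Ioi (0 : ℝ),
      branch (b * Complex.I) * g (b * Complex.I)).re - (Complex.I * Φ R).re) atTop
      (𝓝 (∫ s in Ioi (0 : ℝ), cutDensity s * (g (s * Complex.I)).re)) := by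
    have := (Complex.continuous_re.tendsto _).comp (hinf.const_mul Complex.I)
    simpa [hval] using this.const_sub (∫ s in Ioi (0 : ℝ), cutDensity s * (g (s * Complex.I)).re)
  refine hlast.congr' ?_
  filter_upwards [eventually_gt_atTop 0] with R hR
  exact (hfin R hR).symm

end Contour

/-! ### The representing measure of the kernel -/

/-- The density of the measure whose Laplace transform is the kernel. -/
def density (s : ℝ) : ℝ := cutDensity s / Real.pi

lemma measurable_density : Measurable density := by
  unfold density cutDensity
  have : Measurable Real.tan := by
    have h : Real.tan = fun x => Real.sin x / Real.cos x := funext Real.tan_eq_sin_div_cos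
    rw [h]; fun_prop
  fun_prop

lemma density_nonneg (s : ℝ) : 0 ≤ density s := by
  have := Real.pi_pos
  unfold density cutDensity; positivity

/-- The absence of mass near `0` means that later bounds are needed only for `s > 1`; it also gives
the kernel its exponential decay. -/
lemma density_eq_zero {s : ℝ} (h0 : 0 < s) (h1 : s ≤ 1) : density s = 0 := by
  have := Real.tan_nonneg_of_nonneg_of_le_pi_div_two h0.le (by linarith [Real.pi_gt_three])
  rw [density, cutDensity, Real.sqrt_eq_zero_of_nonpos (neg_nonpos.2 (by positivity)), zero_div]

/-- One interval of positive density suffices for all the strict inequalities below. -/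
lemma density_pos {s : ℝ} (h0 : Real.pi / 2 < s) (h1 : s < Real.pi) : 0 < density s := by
  have hpi := Real.pi_pos
  have h := Real.tan_neg_of_neg_of_pi_div_two_lt (x := s - Real.pi) (by linarith) (by linarith)
  rw [Real.tan_sub_pi] at h
  have : Real.tan s / s < 0 := div_neg_of_neg_of_pos h (by linarith)
  exact div_pos (Real.sqrt_pos.2 (by linarith)) hpi

lemma density_le {s : ℝ} (h0 : 0 < s) : density s ≤ 1 / Real.sqrt (s * |Real.cos s|) := by
  have h1 : cutDensity s ≤ 1 / Real.sqrt (s * |Real.cos s|) := by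
    rw [cutDensity, one_div, ← Real.sqrt_inv]
    refine Real.sqrt_le_sqrt ((neg_le_abs _).trans ?_)
    rw [abs_div, abs_of_pos h0, Real.tan_eq_sin_div_cos, abs_div, div_div, mul_comm, div_eq_mul_inv]
    exact mul_le_of_le_one_left (by positivity) (Real.abs_sin_le_one s)
  refine le_trans (div_le_self ?_ (by linarith [Real.pi_gt_three])) h1
  exact Real.sqrt_nonneg _

lemma integrableOn_density_div : IntegrableOn (fun s => density s / s) (Ioi 0) := by
  refine (integrableOn_majorant.const_mul 2).mono'
    (measurable_density.div measurable_id).aestronglyMeasurable ?_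
  refine (ae_restrict_iff' measurableSet_Ioi).2 (.of_forall fun s hs => ?_)
  have hs0 : 0 < s := hs
  have hm := majorant_nonneg hs0
  rw [Real.norm_of_nonneg (div_nonneg (density_nonneg s) hs0.le)]
  rcases le_or_gt s 1 with h | h
  · rw [density_eq_zero hs0 h]; simpa using hm
  · calc density s / s ≤ 1 / Real.sqrt (s * |Real.cos s|) / s := by gcongr; exact density_le hs0
      _ ≤ 1 / Real.sqrt (s * |Real.cos s|) / ((1 + s) / 2) := by gcongr; linarith
      _ = 2 * majorant s := by rw [majorant]; field_simp

/-- Functions of size `O(1 / s)` are integrable against the representing measure. -/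
lemma integrableOn_density_mul {h : ℝ → ℝ} {C : ℝ}
    (hm : AEStronglyMeasurable h (volume.restrict (Ioi 0)))
    (hb : ∀ s, 1 < s → |h s| ≤ C / s) : IntegrableOn (fun s => density s * h s) (Ioi 0) := by
  refine (integrableOn_density_div.const_mul C).mono'
    (measurable_density.aestronglyMeasurable.mul hm) ?_
  refine (ae_restrict_iff' measurableSet_Ioi).2 (.of_forall fun s hs => ?_)
  have hs0 : 0 < s := hs
  rcases le_or_gt s 1 with h1 | h1
  · simp [density_eq_zero hs0 h1]
  · rw [norm_mul, Real.norm_of_nonneg (density_nonneg s), Real.norm_eq_abs]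
    calc density s * |h s| ≤ density s * (C / s) := by
          gcongr
          · exact density_nonneg s
          · exact hb s h1
      _ = C * (density s / s) := by ring

/-- The integral of a positive function against the representing measure is positive. -/
lemma integral_density_mul_pos {h : ℝ → ℝ}
    (hi : IntegrableOn (fun s => density s * h s) (Ioi 0)) (hp : ∀ s, 0 < s → 0 < h s) :
    0 < ∫ s in Ioi 0, density s * h s := by
  have hpi := Real.pi_pos
  rw [setIntegral_pos_iff_support_of_nonneg_ae ?_ hi]
  · have hsub : Ioo (Real.pi / 2) Real.pi ⊆
        Function.support (fun s => density s * h s) ∩ Ioi 0 := fun s hs => by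
      have h0 : 0 < s := by linarith [hs.1]
      exact ⟨(mul_pos (density_pos hs.1 hs.2) (hp s h0)).ne', h0⟩
    refine lt_of_lt_of_le ?_ (measure_mono hsub)
    rw [Real.volume_Ioo]
    simpa using hpi
  · exact (ae_restrict_iff' measurableSet_Ioi).2 (.of_forall fun s hs =>
      mul_nonneg (density_nonneg s) (hp s hs).le)

lemma mul_exp_neg_le {x s : ℝ} (hx : 0 < x) (hs : 0 < s) : Real.exp (-(s * x)) ≤ (1 / x) / s := by
  rw [Real.exp_neg, div_div, one_div]
  have := Real.add_one_le_exp (s * x)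
  apply inv_anti₀ (by positivity)
  nlinarith

lemma integrableOn_density_mul_exp {x : ℝ} (hx : 0 < x) :
    IntegrableOn (fun s => density s * Real.exp (-(s * x))) (Ioi 0) :=
  integrableOn_density_mul (Measurable.aestronglyMeasurable (by fun_prop)) fun s hs => by
    rw [abs_of_pos (Real.exp_pos _)]; exact mul_exp_neg_le hx (by linarith)

/-! ### The kernel as a Laplace transform -/

/-- The Laplace transform of the representing measure. -/
def laplaceKernel (x : ℝ) : ℝ := ∫ s in Ioi 0, density s * Real.exp (-(s * x))

lemma tendsto_integral_symbol_cos {y : ℝ} (hy : 0 < y) :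
    Tendsto (fun R : ℝ => ∫ ξ in 0..R, symbol ξ * Real.cos (y * ξ)) atTop
      (𝓝 (Real.pi * laplaceKernel y)) := by
  have key : ∀ a b : ℝ, Complex.I * y * (a + b * Complex.I) =
      ((-(y * b) : ℝ) : ℂ) + ((y * a : ℝ) : ℂ) * Complex.I := fun a b => by
    push_cast
    linear_combination (y * b : ℂ) * Complex.I_sq
  -- The constant `1 + 1/y` comes from `1 + b ≤ (1 + yb)(1 + 1/y) ≤ exp(yb)(1 + 1/y)`.
  have h := tendsto_integral_symbol_mul (g := fun z => Complex.exp (Complex.I * y * z))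
    (C := 1 + 1 / y) (fun a b _ _ => by fun_prop) (fun a b _ hb => ?_) (fun b _ => ?_)
  · have e1 : ∀ ξ : ℝ, (Complex.exp (Complex.I * y * ξ)).re = Real.cos (y * ξ) := fun ξ => by
      have := key ξ 0
      simp only [Complex.ofReal_zero, zero_mul, add_zero, mul_zero, neg_zero, zero_add] at this
      rw [this, Complex.exp_ofReal_mul_I_re]
    have e2 : ∀ s : ℝ, (Complex.exp (Complex.I * y * (s * Complex.I))).re =
        Real.exp (-(s * y)) := fun s => by
      have := key 0 s
      simp only [Complex.ofReal_zero, zero_mul, add_zero, mul_zero, zero_add] at this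
      rw [this, Complex.exp_ofReal_re, mul_comm y]
    simp only [e1, e2] at h
    convert h using 2
    rw [laplaceKernel, ← integral_const_mul]
    congr 1; funext s
    rw [density]; field_simp
  · rw [key, Complex.norm_exp]
    simp only [Complex.add_re, Complex.ofReal_re, Complex.mul_re, Complex.I_re, mul_zero,
      Complex.ofReal_im, zero_mul, sub_zero, add_zero]
    rw [Real.exp_neg, le_div_iff₀ (by positivity), inv_mul_le_iff₀ (Real.exp_pos _)]
    have := Real.add_one_le_exp (y * b)
    have h2 : 1 + b ≤ (y * b + 1) * (1 + 1 / y) := by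
      have : (y * b + 1) * (1 + 1 / y) = 1 + b + (y * b + 1 / y) := by field_simp; ring
      rw [this]
      have : 0 ≤ y * b + 1 / y := by positivity
      linarith
    refine h2.trans ?_
    gcongr
  · have := key 0 b
    simp only [Complex.ofReal_zero, zero_mul, add_zero, mul_zero, zero_add] at this
    rw [this, Complex.exp_ofReal_im]

lemma integral_symbol_exp (x R : ℝ) :
    (1 / (2 * Real.pi) : ℂ) *
      ∫ ξ in (-R)..R, (symbol ξ : ℂ) * Complex.exp (Complex.I * x * ξ) =
    ((1 / Real.pi * ∫ ξ in 0..R, symbol ξ * Real.cos (|x| * ξ) : ℝ) : ℂ) := by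
  have hc : Continuous fun ξ : ℝ => (symbol ξ : ℂ) * Complex.exp (Complex.I * x * ξ) :=
    (Complex.continuous_ofReal.comp continuous_symbol).mul (by fun_prop)
  have hc' : Continuous fun ξ : ℝ => (symbol (-ξ) : ℂ) * Complex.exp (Complex.I * x * (-ξ : ℝ)) :=
    hc.comp continuous_neg
  have h1 : ∫ ξ in (-R)..0, (symbol ξ : ℂ) * Complex.exp (Complex.I * x * ξ) =
      ∫ ξ in 0..R, (symbol (-ξ) : ℂ) * Complex.exp (Complex.I * x * (-ξ : ℝ)) := by
    rw [intervalIntegral.integral_comp_neg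
      (fun ξ : ℝ => (symbol ξ : ℂ) * Complex.exp (Complex.I * x * ξ)), neg_zero]
  rw [← intervalIntegral.integral_add_adjacent_intervals (hc.intervalIntegrable _ 0)
    (hc.intervalIntegrable _ _), h1, ← intervalIntegral.integral_add (hc'.intervalIntegrable _ _)
    (hc.intervalIntegrable _ _)]
  have h2 : ∀ ξ : ℝ, (symbol (-ξ) : ℂ) * Complex.exp (Complex.I * x * (-ξ : ℝ)) +
      (symbol ξ : ℂ) * Complex.exp (Complex.I * x * ξ) =
      ((2 * (symbol ξ * Real.cos (|x| * ξ)) : ℝ) : ℂ) := fun ξ => by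
    have h3 : Real.cos (|x| * ξ) = Real.cos (x * ξ) := by
      rcases abs_choice x with h | h <;> rw [h]
      rw [neg_mul, Real.cos_neg]
    rw [symbol_neg, h3]
    push_cast
    rw [Complex.cos]
    ring_nf
  simp only [h2]
  rw [intervalIntegral.integral_ofReal, intervalIntegral.integral_const_mul]
  push_cast
  field_simp

lemma kernel_eq {x : ℝ} (hx : x ≠ 0) : kernel x = laplaceKernel |x| := by
  have h := (tendsto_integral_symbol_cos (abs_pos.2 hx)).const_mul (1 / Real.pi)
  have h2 := (Complex.continuous_ofReal.tendsto _).comp h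
  have h3 : Tendsto (fun R : ℝ => (1 / (2 * Real.pi) : ℂ) *
      ∫ ξ in (-R)..R, (symbol ξ : ℂ) * Complex.exp (Complex.I * x * ξ)) atTop
      (𝓝 ((1 / Real.pi * (Real.pi * laplaceKernel |x|) : ℝ) : ℂ)) :=
    h2.congr fun R => (integral_symbol_exp x R).symm
  rw [kernel, h3.limUnder_eq, Complex.ofReal_re]
  field_simp

/-! ### The total mass of the kernel -/

/-- Contour rotation for `g(z) = 1 / (δ - iz)`, whose real part on the real axis is the Poisson
kernel `δ / (δ² + ξ²)`; then `ξ = δu`. As `δ → 0` the left side sees only the value of the symbol at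
`0`. -/
lemma integral_symbol_poisson {δ : ℝ} (hδ : 0 < δ) :
    ∫ u in Ioi (0 : ℝ), symbol (δ * u) * (1 + u ^ 2)⁻¹ =
      ∫ s in Ioi (0 : ℝ), cutDensity s * (1 / (δ + s)) := by
  have key : ∀ a b : ℝ, (δ : ℂ) - Complex.I * (a + b * Complex.I) =
      ((δ + b : ℝ) : ℂ) + ((-a : ℝ) : ℂ) * Complex.I := fun a b => by
    push_cast
    linear_combination (-b : ℂ) * Complex.I_sq
  have hne : ∀ a b : ℝ, 0 ≤ b → (δ : ℂ) - Complex.I * (a + b * Complex.I) ≠ 0 := fun a b hb => by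
    rw [key]
    exact add_mul_I_ne_zero (Or.inl (by positivity))
  have h := tendsto_integral_symbol_mul (g := fun z => 1 / (δ - Complex.I * z))
    (C := 1 + 1 / δ) (fun a b _ hb => ?_) (fun a b _ hb => ?_) (fun b _ => ?_)
  · have e1 : ∀ ξ : ℝ, (1 / ((δ : ℂ) - Complex.I * ξ)).re = δ⁻¹ * (1 + (δ⁻¹ * ξ) ^ 2)⁻¹ := fun ξ => by
      have := key ξ 0
      simp only [Complex.ofReal_zero, zero_mul, add_zero] at this
      rw [this, one_div, Complex.inv_re, Complex.normSq_add_mul_I]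
      simp only [Complex.add_re, Complex.ofReal_re, Complex.mul_re, Complex.I_re, mul_zero,
        Complex.ofReal_im, zero_mul, sub_zero, add_zero, Complex.I_im]
      field_simp
    have e2 : ∀ s : ℝ, (1 / ((δ : ℂ) - Complex.I * (s * Complex.I))).re = 1 / (δ + s) := fun s => by
      have := key 0 s
      simp only [Complex.ofReal_zero, zero_add, neg_zero, zero_mul, add_zero] at this
      rw [this, ← Complex.ofReal_one, ← Complex.ofReal_div, Complex.ofReal_re]
    simp only [e1, e2] at h
    have hint : IntegrableOn (fun ξ => symbol ξ * (δ⁻¹ * (1 + (δ⁻¹ * ξ) ^ 2)⁻¹)) (Ioi 0) := by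
      have h1 : IntegrableOn (fun ξ => δ⁻¹ * (1 + (δ⁻¹ * ξ) ^ 2)⁻¹) (Ioi 0) :=
        ((integrable_inv_one_add_sq.comp_mul_left' (inv_pos.2 hδ).ne').const_mul _).integrableOn
      refine h1.mono' (continuous_symbol.measurable.mul (by fun_prop)).aestronglyMeasurable ?_
      refine (ae_restrict_iff' measurableSet_Ioi).2 (.of_forall fun ξ hξ => ?_)
      rw [Real.norm_of_nonneg (mul_nonneg (symbol_nonneg ξ) (by positivity))]
      exact mul_le_of_le_one_left (by positivity) (symbol_le_one hξ)
    have h2 := intervalIntegral_tendsto_integral_Ioi 0 hint tendsto_id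
    rw [← tendsto_nhds_unique h2 h]
    have h3 := integral_comp_mul_left_Ioi
      (fun ξ => symbol ξ * (δ⁻¹ * (1 + (δ⁻¹ * ξ) ^ 2)⁻¹)) 0 hδ
    rw [mul_zero, smul_eq_mul] at h3
    rw [eq_inv_mul_iff_mul_eq₀ hδ.ne', ← integral_const_mul] at h3
    rw [← h3]
    congr 1; funext u
    rw [inv_mul_cancel_left₀ hδ.ne']
    field_simp
  · refine DifferentiableAt.div (by fun_prop) (by fun_prop) (hne a b hb)
  · have h1 : δ + b ≤ ‖(δ : ℂ) - Complex.I * (a + b * Complex.I)‖ := by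
      rw [key]
      exact (le_abs_self _).trans (le_norm_add_mul_I_re _ _)
    have h0 : 0 < δ + b := by positivity
    rw [norm_div, norm_one]
    calc _ ≤ 1 / (δ + b) := by gcongr
      _ ≤ _ := by
        rw [div_le_div_iff₀ h0 (by positivity)]
        have : (1 + 1 / δ) * (δ + b) = 1 + b + (δ + b / δ) := by field_simp; ring
        rw [this]
        have : 0 ≤ δ + b / δ := by positivity
        linarith
  · have := key 0 b
    simp only [Complex.ofReal_zero, zero_add, neg_zero, zero_mul, add_zero] at this
    rw [this, ← Complex.ofReal_one, ← Complex.ofReal_div, Complex.ofReal_im]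

/-- As `δ → 0` the Poisson identity becomes `m(0) · π/2 = π ∫ density(s)/s ds`. Since `∫₀^∞ exp(-st)
dt = 1/s`, this says that the kernel has mass `1/2` on each half line. -/
lemma integral_density_div : ∫ s in Ioi (0 : ℝ), density s / s = 1 / 2 := by
  have hpi := Real.pi_pos
  have hl : Tendsto (fun δ : ℝ => ∫ u in Ioi (0 : ℝ), symbol (δ * u) * (1 + u ^ 2)⁻¹) (𝓝[>] 0)
      (𝓝 (∫ u in Ioi (0 : ℝ), (1 + u ^ 2)⁻¹)) := by
    refine tendsto_integral_filter_of_dominated_convergence (fun u => (1 + u ^ 2)⁻¹)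
      (.of_forall fun δ => ?_) ?_ integrable_inv_one_add_sq.integrableOn ?_
    · exact ((continuous_symbol.comp (by fun_prop)).measurable.mul
        (by fun_prop)).aestronglyMeasurable
    · filter_upwards [eventually_mem_nhdsWithin] with δ hδ
      refine (ae_restrict_iff' measurableSet_Ioi).2 (.of_forall fun u hu => ?_)
      rw [Real.norm_of_nonneg (mul_nonneg (symbol_nonneg _) (by positivity))]
      exact mul_le_of_le_one_left (by positivity) (symbol_le_one (mul_pos hδ hu))
    · refine .of_forall fun u => ?_
      have h1 : Tendsto (fun δ : ℝ => symbol (δ * u)) (𝓝[>] 0) (𝓝 1) := by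
        have : Continuous fun δ : ℝ => symbol (δ * u) := continuous_symbol.comp (by fun_prop)
        have := (this.tendsto 0).mono_left (nhdsWithin_le_nhds (s := Ioi 0))
        simpa [symbol] using this
      simpa using h1.mul_const ((1 + u ^ 2)⁻¹)
  have hr : Tendsto (fun δ : ℝ => ∫ s in Ioi (0 : ℝ), cutDensity s * (1 / (δ + s))) (𝓝[>] 0)
      (𝓝 (∫ s in Ioi (0 : ℝ), Real.pi * (density s / s))) := by
    have hcd : ∀ s, cutDensity s = Real.pi * density s := fun s => by rw [density]; field_simp
    refine tendsto_integral_filter_of_dominated_convergence (fun s => Real.pi * (density s / s))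
      (.of_forall fun δ => ?_) ?_ (integrableOn_density_div.const_mul _) ?_
    · simp only [hcd]
      exact ((measurable_density.const_mul _).mul (by fun_prop)).aestronglyMeasurable
    · filter_upwards [eventually_mem_nhdsWithin] with δ hδ
      refine (ae_restrict_iff' measurableSet_Ioi).2 (.of_forall fun s hs => ?_)
      have hδ' : 0 < δ := hδ
      have hs' : 0 < s := hs
      have := density_nonneg s
      rw [Real.norm_of_nonneg (by rw [hcd]; positivity), hcd, mul_assoc, mul_one_div]
      gcongr
      linarith
    · refine (ae_restrict_iff' measurableSet_Ioi).2 (.of_forall fun s hs => ?_)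
      have hs' : 0 < s := hs
      have h1 : Tendsto (fun δ : ℝ => 1 / (δ + s)) (𝓝[>] 0) (𝓝 (1 / s)) := by
        have : ContinuousAt (fun δ : ℝ => 1 / (δ + s)) 0 :=
          ContinuousAt.div (by fun_prop) (by fun_prop) (by simpa using hs'.ne')
        have := this.tendsto.mono_left (nhdsWithin_le_nhds (s := Ioi 0))
        simpa using this
      have := h1.const_mul (cutDensity s)
      convert this using 2
      rw [hcd]; ring
  have := tendsto_nhds_unique (hl.congr' ?_) hr
  · rw [integral_Ioi_inv_one_add_sq, Real.arctan_zero, integral_const_mul] at this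
    have h2 : Real.pi * (∫ s in Ioi (0 : ℝ), density s / s) = Real.pi * (1 / 2) := by linarith
    exact mul_left_cancel₀ hpi.ne' h2
  · filter_upwards [eventually_mem_nhdsWithin] with δ hδ
    exact integral_symbol_poisson hδ

/-! ### Laplace transforms on the half line -/

/-- The Laplace transform of a function on the half line. -/
def laplace (h : ℝ → ℝ) (s : ℝ) : ℝ := ∫ t in Ioi 0, Real.exp (-(s * t)) * h t

lemma integrableOn_exp_neg {s : ℝ} (hs : 0 < s) :
    IntegrableOn (fun t => Real.exp (-(s * t))) (Ioi 0) := by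
  simpa using integrableOn_exp_mul_Ioi (neg_lt_zero.2 hs) 0

lemma integral_exp_neg {s : ℝ} (hs : 0 < s) : ∫ t in Ioi 0, Real.exp (-(s * t)) = 1 / s := by
  simpa using integral_exp_mul_Ioi (neg_lt_zero.2 hs) 0

lemma integrableOn_exp_neg_mul {h : ℝ → ℝ} {C s : ℝ} (hc : Continuous h) (hC : ∀ t, |h t| ≤ C)
    (hs : 0 < s) : IntegrableOn (fun t => Real.exp (-(s * t)) * h t) (Ioi 0) :=
  (integrableOn_exp_neg hs).mul_bdd (c := C) hc.aestronglyMeasurable (.of_forall hC)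

lemma laplace_const (c : ℝ) {s : ℝ} (hs : 0 < s) : laplace (fun _ => c) s = c / s := by
  rw [laplace, integral_mul_const, integral_exp_neg hs]; ring

lemma laplace_mono {h₁ h₂ : ℝ → ℝ} {C₁ C₂ s : ℝ} (hc₁ : Continuous h₁) (hC₁ : ∀ t, |h₁ t| ≤ C₁)
    (hc₂ : Continuous h₂) (hC₂ : ∀ t, |h₂ t| ≤ C₂) (hs : 0 < s) (h : ∀ t, 0 < t → h₁ t ≤ h₂ t) :
    laplace h₁ s ≤ laplace h₂ s :=
  setIntegral_mono_on (integrableOn_exp_neg_mul hc₁ hC₁ hs) (integrableOn_exp_neg_mul hc₂ hC₂ hs)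
    measurableSet_Ioi fun t ht => mul_le_mul_of_nonneg_left (h t ht) (Real.exp_pos _).le

lemma laplace_pos {h : ℝ → ℝ} {C s : ℝ} (hc : Continuous h) (hC : ∀ t, |h t| ≤ C) (hs : 0 < s)
    (hn : ∀ t, 0 < t → 0 ≤ h t) (hp : ∃ t, 0 ≤ t ∧ h t ≠ 0) : 0 < laplace h s := by
  rw [laplace, setIntegral_pos_iff_support_of_nonneg_ae
    ((ae_restrict_iff' measurableSet_Ioi).2 (.of_forall fun t ht =>
      mul_nonneg (Real.exp_pos _).le (hn t ht))) (integrableOn_exp_neg_mul hc hC hs)]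
  obtain ⟨t, ht, hpt⟩ := hp
  have hopen : IsOpen (Function.support (fun t => Real.exp (-(s * t)) * h t)) :=
    Continuous.isOpen_support (by fun_prop)
  have hcl : t ∈ closure (Ioi (0 : ℝ)) := by rwa [closure_Ioi]
  exact (hopen.inter isOpen_Ioi).measure_pos _
    (mem_closure_iff.1 hcl _ hopen (mul_ne_zero (Real.exp_pos _).ne' hpt))

lemma laplace_deriv {h h' : ℝ → ℝ} {C C' s : ℝ} (hd : ∀ t, HasDerivAt h (h' t) t)
    (hc' : Continuous h') (hC : ∀ t, |h t| ≤ C) (hC' : ∀ t, |h' t| ≤ C') (hs : 0 < s) :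
    laplace h' s = s * laplace h s - h 0 := by
  have hc : Continuous h := continuous_iff_continuousAt.2 fun t => (hd t).continuousAt
  have he : ∀ t, HasDerivAt (fun t => Real.exp (-(s * t))) (-(s * Real.exp (-(s * t)))) t := fun t => by
    have := (((hasDerivAt_id t).const_mul s).neg).exp
    refine this.congr_deriv ?_
    simp; ring
  have hi := integrableOn_exp_neg_mul hc hC hs
  have hi' := integrableOn_exp_neg_mul hc' hC' hs
  have hder : ∀ t ∈ Ioi (0 : ℝ), HasDerivAt (fun t => Real.exp (-(s * t)) * h t)
      (Real.exp (-(s * t)) * h' t - s * (Real.exp (-(s * t)) * h t)) t := fun t _ =>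
    ((he t).mul (hd t)).congr_deriv (by ring)
  have hlim : Tendsto (fun t => Real.exp (-(s * t)) * h t) atTop (𝓝 0) := by
    have h0 : Tendsto (fun t : ℝ => Real.exp (-(s * t))) atTop (𝓝 0) :=
      Real.tendsto_exp_neg_atTop_nhds_zero.comp (tendsto_id.const_mul_atTop hs)
    have h1 : Tendsto (fun t : ℝ => Real.exp (-(s * t)) * C) atTop (𝓝 0) := by
      simpa using h0.mul_const C
    refine squeeze_zero_norm (fun t => ?_) h1
    rw [norm_mul, Real.norm_of_nonneg (Real.exp_pos _).le]
    exact mul_le_mul_of_nonneg_left (hC t) (Real.exp_pos _).le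
  have := integral_Ioi_of_hasDerivAt_of_tendsto (a := 0) (m := 0) (by fun_prop) hder
    (hi'.sub (hi.const_mul s)) hlim
  rw [integral_sub hi' (hi.const_mul s), integral_const_mul] at this
  simp only [mul_zero, neg_zero, Real.exp_zero, one_mul, zero_sub] at this
  unfold laplace
  linarith

lemma laplace_periodic {h : ℝ → ℝ} {C s P : ℝ} (hc : Continuous h) (hC : ∀ t, |h t| ≤ C)
    (hs : 0 < s) (hP : 0 < P) (hper : Function.Periodic h P) :
    (1 - Real.exp (-(s * P))) * laplace h s = ∫ t in 0..P, Real.exp (-(s * t)) * h t := by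
  have hi := integrableOn_exp_neg_mul hc hC hs
  have h1 : ∫ t in Ioi P, Real.exp (-(s * t)) * h t = Real.exp (-(s * P)) * laplace h s := by
    have := (measurePreserving_add_right volume P).setIntegral_preimage_emb
      (measurableEmbedding_addRight P) (fun t => Real.exp (-(s * t)) * h t) (Ioi P)
    rw [preimage_add_const_Ioi, sub_self] at this
    rw [← this, laplace, ← integral_const_mul]
    congr 1; funext t
    rw [hper t, ← mul_assoc, ← Real.exp_add]
    ring_nf
  have h2 := intervalIntegral.integral_Ioi_sub_Ioi hi hP.le
  rw [h1] at h2
  rw [← h2, laplace]; ring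

/-! ### The convolution operator -/

/-- Integrating first in `t` leaves `density s / s`. This is the integrability behind every exchange
of the `s` and `t` integrals. -/
lemma integrable_density_exp_prod : Integrable
    (fun p : ℝ × ℝ => density p.1 * Real.exp (-(p.1 * p.2)))
    ((volume.restrict (Ioi 0)).prod (volume.restrict (Ioi 0))) := by
  rw [integrable_prod_iff]
  · refine ⟨(ae_restrict_iff' measurableSet_Ioi).2 (.of_forall fun s hs =>
      Integrable.const_mul (integrableOn_exp_neg hs) (density s)), ?_⟩
    refine integrableOn_density_div.congr ?_
    refine (ae_restrict_iff' measurableSet_Ioi).2 (.of_forall fun s hs => ?_)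
    have : ∀ t, ‖density s * Real.exp (-(s * t))‖ = density s * Real.exp (-(s * t)) := fun t =>
      Real.norm_of_nonneg (mul_nonneg (density_nonneg s) (Real.exp_pos _).le)
    simp only [this]
    rw [integral_const_mul, integral_exp_neg hs]
    ring
  · exact ((measurable_density.comp measurable_fst).mul (by fun_prop)).aestronglyMeasurable

lemma integrableOn_laplaceKernel : IntegrableOn laplaceKernel (Ioi 0) :=
  integrable_density_exp_prod.integral_prod_right

section

variable {h : ℝ → ℝ} {C : ℝ}

lemma integrableOn_laplaceKernel_mul (hc : Continuous h) (hC : ∀ t, |h t| ≤ C) :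
    IntegrableOn (fun t => laplaceKernel t * h t) (Ioi 0) :=
  integrableOn_laplaceKernel.mul_bdd (c := C) hc.aestronglyMeasurable (.of_forall hC)

lemma integrable_density_exp_mul_prod (hc : Continuous h) (hC : ∀ t, |h t| ≤ C) : Integrable
    (fun p : ℝ × ℝ => density p.1 * Real.exp (-(p.1 * p.2)) * h p.2)
    ((volume.restrict (Ioi 0)).prod (volume.restrict (Ioi 0))) :=
  integrable_density_exp_prod.mul_bdd (c := C) (hc.comp continuous_snd).aestronglyMeasurable
    (.of_forall fun p => hC p.2)

lemma integrableOn_density_mul_laplace (hc : Continuous h) (hC : ∀ t, |h t| ≤ C) :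
    IntegrableOn (fun s => density s * laplace h s) (Ioi 0) := by
  have := (integrable_density_exp_mul_prod hc hC).integral_prod_left
  refine this.congr (.of_forall fun s => ?_)
  simp only [laplace, mul_assoc, integral_const_mul]

lemma integral_laplaceKernel_mul (hc : Continuous h) (hC : ∀ t, |h t| ≤ C) :
    ∫ t in Ioi 0, laplaceKernel t * h t = ∫ s in Ioi 0, density s * laplace h s := by
  have := integral_integral_swap (f := fun s t => density s * Real.exp (-(s * t)) * h t)
    (integrable_density_exp_mul_prod hc hC)
  simp only [laplace, laplaceKernel, ← integral_mul_const, ← integral_const_mul, ← mul_assoc]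
  exact this.symm

end

lemma L_eq {f : ℝ → ℝ} {C : ℝ} (hc : Continuous f) (hC : ∀ t, |f t| ≤ C) (x : ℝ) :
    L f x = ∫ t in Ioi 0, laplaceKernel t * (f (x + t) + f (x - t)) := by
  have h1 : L f x = ∫ t, kernel t * f (x - t) := by
    rw [L, ← integral_sub_left_eq_self _ volume x]
    simp only [sub_sub_cancel]
  have h2 : L f x = ∫ t, laplaceKernel |t| * f (x - t) := by
    rw [h1]
    refine integral_congr_ae ?_
    have : ∀ᵐ t : ℝ, t ≠ 0 := by simp [ae_iff]
    filter_upwards [this] with t ht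
    rw [kernel_eq ht]
  have hk₁ : IntegrableOn (fun t => laplaceKernel t * f (x + t)) (Ioi 0) :=
    integrableOn_laplaceKernel_mul (h := fun t => f (x + t)) (by fun_prop) fun t => hC _
  have hk₂ : IntegrableOn (fun t => laplaceKernel t * f (x - t)) (Ioi 0) :=
    integrableOn_laplaceKernel_mul (h := fun t => f (x - t)) (by fun_prop) fun t => hC _
  have hp : IntegrableOn (fun t => laplaceKernel |t| * f (x - t)) (Ioi 0) :=
    hk₂.congr_fun (fun t ht => by rw [abs_of_pos ht]) measurableSet_Ioi
  have e1 : ∀ t ∈ Ioi (0 : ℝ), laplaceKernel t * f (x + t) =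
      (fun t => laplaceKernel |t| * f (x - t)) (-t) := fun t ht => by
    simp only [abs_neg, abs_of_pos (mem_Ioi.1 ht), sub_neg_eq_add]
  have hn : IntegrableOn (fun t => laplaceKernel |t| * f (x - t)) (Iic 0) := by
    have := hk₁.congr_fun e1 measurableSet_Ioi
    rw [integrableOn_Iic_iff_integrableOn_Iio]
    have h3 := this.comp_neg
    simpa using h3
  rw [h2, ← intervalIntegral.integral_Iic_add_Ioi hn hp]
  have h4 := integral_comp_neg_Ioi 0 (fun t => laplaceKernel |t| * f (x - t))
  rw [neg_zero] at h4
  have e2 : ∀ t ∈ Ioi (0 : ℝ), laplaceKernel |t| * f (x - t) = laplaceKernel t * f (x - t) :=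
    fun t ht => by rw [abs_of_pos ht]
  rw [← h4, ← setIntegral_congr_fun measurableSet_Ioi e1, setIntegral_congr_fun measurableSet_Ioi e2,
    ← integral_add hk₁ hk₂]
  simp only [mul_add]

/-- The operator `L` as a superposition of Laplace transforms. -/
lemma L_eq_integral_laplace {f : ℝ → ℝ} {C : ℝ} (hc : Continuous f) (hC : ∀ t, |f t| ≤ C) (x : ℝ) :
    L f x = ∫ s in Ioi 0, density s * laplace (fun t => f (x + t) + f (x - t)) s := by
  rw [L_eq hc hC, integral_laplaceKernel_mul (C := C + C) (by fun_prop)]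
  exact fun t => (abs_add_le _ _).trans (add_le_add (hC _) (hC _))

/-- The derivative falls on `f` alone; the kernel, singular at the origin, is only required to be
integrable. -/
lemma hasDerivAt_L {f f' : ℝ → ℝ} {C C' : ℝ} (hd : ∀ t, HasDerivAt f (f' t) t)
    (hc' : Continuous f') (hC : ∀ t, |f t| ≤ C) (hC' : ∀ t, |f' t| ≤ C') (x : ℝ) :
    HasDerivAt (L f) (L f' x) x := by
  have hc : Continuous f := continuous_iff_continuousAt.2 fun t => (hd t).continuousAt
  rw [L_eq hc' hC', funext (L_eq hc hC)]
  have hi : ∀ x, IntegrableOn (fun t => laplaceKernel t * (f (x + t) + f (x - t))) (Ioi 0) := fun x =>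
    integrableOn_laplaceKernel_mul (h := fun t => f (x + t) + f (x - t)) (C := C + C) (by fun_prop)
      fun t => (abs_add_le _ _).trans (add_le_add (hC _) (hC _))
  have hi' : IntegrableOn (fun t => laplaceKernel t * (f' (x + t) + f' (x - t))) (Ioi 0) :=
    integrableOn_laplaceKernel_mul (h := fun t => f' (x + t) + f' (x - t)) (C := C' + C')
      (by fun_prop) fun t => (abs_add_le _ _).trans (add_le_add (hC' _) (hC' _))
  refine (hasDerivAt_integral_of_dominated_loc_of_deriv_le (s := univ)
    (bound := fun t => |laplaceKernel t| * (C' + C')) univ_mem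
    (.of_forall fun x => (hi x).aestronglyMeasurable) (hi x) hi'.aestronglyMeasurable
    (F' := fun x t => laplaceKernel t * (f' (x + t) + f' (x - t)))
    (.of_forall fun t y _ => ?_) (integrableOn_laplaceKernel.abs.mul_const _)
    (.of_forall fun t y _ => ?_)).2
  · rw [norm_mul, Real.norm_eq_abs]
    exact mul_le_mul_of_nonneg_left ((abs_add_le _ _).trans (add_le_add (hC' _) (hC' _)))
      (abs_nonneg _)
  · exact (((hd (y + t)).comp_add_const y t).add ((hd (y - t)).comp_sub_const y t)).const_mul _

/-- Integration by parts; the odd difference vanishes at `t = 0`, so there is no boundary term. -/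
lemma laplace_first_deriv {f f' : ℝ → ℝ} {C C' : ℝ} (hd : ∀ t, HasDerivAt f (f' t) t)
    (hc' : Continuous f') (hC : ∀ t, |f t| ≤ C) (hC' : ∀ t, |f' t| ≤ C') (x : ℝ) {s : ℝ}
    (hs : 0 < s) : laplace (fun t => f' (x + t) + f' (x - t)) s =
      s * laplace (fun t => f (x + t) - f (x - t)) s := by
  have := laplace_deriv (h := fun t => f (x + t) - f (x - t))
    (h' := fun t => f' (x + t) + f' (x - t)) (C := C + C) (C' := C' + C') (s := s)
    (fun t => ?_) (by fun_prop) (fun t => ?_) (fun t => ?_) hs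
  · rw [this]; simp
  · exact (((hd (x + t)).comp_const_add x t).sub ((hd (x - t)).comp_const_sub x t)).congr_deriv
      (by ring)
  · exact (abs_sub _ _).trans (add_le_add (hC _) (hC _))
  · exact (abs_add_le _ _).trans (add_le_add (hC' _) (hC' _))

/-- Two integrations by parts. Subtracting `2 f x` makes the second boundary term vanish too, and
leaves a quantity of constant sign when `x` is a global extremum. -/
lemma laplace_second_deriv {f f' f'' : ℝ → ℝ} {C C' C'' : ℝ} (hd : ∀ t, HasDerivAt f (f' t) t)
    (hd' : ∀ t, HasDerivAt f' (f'' t) t) (hc'' : Continuous f'') (hC : ∀ t, |f t| ≤ C)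
    (hC' : ∀ t, |f' t| ≤ C') (hC'' : ∀ t, |f'' t| ≤ C'') (x : ℝ) {s : ℝ} (hs : 0 < s) :
    laplace (fun t => f'' (x + t) + f'' (x - t)) s =
      s ^ 2 * laplace (fun t => f (x + t) + f (x - t) - 2 * f x) s := by
  have hc' : Continuous f' := continuous_iff_continuousAt.2 fun t => (hd' t).continuousAt
  have h1 := laplace_deriv (h := fun t => f' (x + t) - f' (x - t))
    (h' := fun t => f'' (x + t) + f'' (x - t)) (C := C' + C') (C' := C'' + C'') (s := s)
    (fun t => ?_) (by fun_prop) (fun t => ?_) (fun t => ?_) hs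
  have h2 := laplace_deriv (h := fun t => f (x + t) + f (x - t) - 2 * f x)
    (h' := fun t => f' (x + t) - f' (x - t)) (C := C + C + 2 * C) (C' := C' + C') (s := s)
    (fun t => ?_) (by fun_prop) (fun t => ?_) (fun t => ?_) hs
  · rw [h1, h2]; simp; ring
  · exact ((((hd (x + t)).comp_const_add x t).add ((hd (x - t)).comp_const_sub x t)).sub_const
      _).congr_deriv (by ring)
  · have h3 : |2 * f x| ≤ 2 * C := by rw [abs_mul, abs_two]; gcongr; exact hC x
    exact (abs_sub _ _).trans (add_le_add ((abs_add_le _ _).trans (add_le_add (hC _) (hC _))) h3)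
  · exact (abs_sub _ _).trans (add_le_add (hC' _) (hC' _))
  · exact (((hd' (x + t)).comp_const_add x t).sub ((hd' (x - t)).comp_const_sub x t)).congr_deriv
      (by ring)
  · exact (abs_sub _ _).trans (add_le_add (hC' _) (hC' _))
  · exact (abs_add_le _ _).trans (add_le_add (hC'' _) (hC'' _))

/-- `L` preserves constants, hence lower bounds. -/
lemma le_L_of_le {f : ℝ → ℝ} {C m : ℝ} (hc : Continuous f) (hC : ∀ t, |f t| ≤ C)
    (hm : ∀ t, m ≤ f t) (x : ℝ) : m ≤ L f x := by
  have h1 : ∫ s in Ioi 0, density s * laplace (fun _ => 2 * m) s = m := by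
    have : ∀ s ∈ Ioi (0 : ℝ), density s * laplace (fun _ => 2 * m) s =
        2 * m * (density s / s) := fun s hs => by rw [laplace_const _ hs]; ring
    rw [setIntegral_congr_fun measurableSet_Ioi this, integral_const_mul, integral_density_div]
    ring
  rw [L_eq_integral_laplace hc hC]
  conv_lhs => rw [← h1]
  have hb : ∀ t, |f (x + t) + f (x - t)| ≤ C + C := fun t =>
    (abs_add_le _ _).trans (add_le_add (hC _) (hC _))
  refine setIntegral_mono_on (integrableOn_density_mul_laplace continuous_const fun _ => le_rfl)
    (integrableOn_density_mul_laplace (by fun_prop) hb) measurableSet_Ioi fun s hs => ?_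
  refine mul_le_mul_of_nonneg_left ?_ (density_nonneg s)
  exact laplace_mono continuous_const (fun _ => le_rfl) (by fun_prop) hb hs fun t _ => by
    linarith [hm (x + t), hm (x - t)]

lemma L_neg (f : ℝ → ℝ) (x : ℝ) : L (fun t => -f t) x = -L f x := by
  simp [L, integral_neg]

lemma L_le_of_le {f : ℝ → ℝ} {C M : ℝ} (hc : Continuous f) (hC : ∀ t, |f t| ≤ C)
    (hM : ∀ t, f t ≤ M) (x : ℝ) : L f x ≤ M := by
  have := le_L_of_le (f := fun t => -f t) (m := -M) hc.neg (fun t => by rw [abs_neg]; exact hC t)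
    (fun t => neg_le_neg (hM t)) x
  rw [L_neg] at this
  linarith

lemma L_pos_of_laplace_pos {f : ℝ → ℝ} {C x : ℝ} (hc : Continuous f) (hC : ∀ t, |f t| ≤ C)
    (h : ∀ s, 0 < s → 0 < laplace (fun t => f (x + t) + f (x - t)) s) : 0 < L f x := by
  rw [L_eq_integral_laplace hc hC]
  refine integral_density_mul_pos (integrableOn_density_mul_laplace (C := C + C) (by fun_prop)
    fun t => ?_) h
  exact (abs_add_le _ _).trans (add_le_add (hC _) (hC _))

lemma L_pos {f : ℝ → ℝ} {C : ℝ} (hc : Continuous f) (hC : ∀ t, |f t| ≤ C) (hn : ∀ t, 0 ≤ f t)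
    (hp : ∃ t, f t ≠ 0) (x : ℝ) : 0 < L f x := by
  refine L_pos_of_laplace_pos hc hC fun s hs => laplace_pos (C := C + C) (by fun_prop)
    (fun t => (abs_add_le _ _).trans (add_le_add (hC _) (hC _))) hs
    (fun t _ => add_nonneg (hn _) (hn _)) ?_
  obtain ⟨y, hy⟩ := hp
  have hy' : 0 < f y := lt_of_le_of_ne (hn y) hy.symm
  rcases le_total x y with h | h
  · refine ⟨y - x, by linarith, ?_⟩
    rw [add_sub_cancel]
    have := hn (x - (y - x))
    positivity
  · refine ⟨x - y, by linarith, ?_⟩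
    rw [sub_sub_cancel]
    have := hn (x + (x - y))
    positivity

/-- At a global minimum of a nonconstant function `f`, the function `L f''` is positive. -/
lemma L_second_deriv_pos {f f' f'' : ℝ → ℝ} {C C' C'' : ℝ} (hd : ∀ t, HasDerivAt f (f' t) t)
    (hd' : ∀ t, HasDerivAt f' (f'' t) t) (hc'' : Continuous f'') (hC : ∀ t, |f t| ≤ C)
    (hC' : ∀ t, |f' t| ≤ C') (hC'' : ∀ t, |f'' t| ≤ C'') {x : ℝ} (hmin : ∀ y, f x ≤ f y)
    (hconst : ¬ ∃ c, ∀ y, f y = c) : 0 < L f'' x := by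
  have hc : Continuous f := continuous_iff_continuousAt.2 fun t => (hd t).continuousAt
  refine L_pos_of_laplace_pos hc'' hC'' fun s hs => ?_
  rw [laplace_second_deriv hd hd' hc'' hC hC' hC'' x hs]
  refine mul_pos (by positivity) (laplace_pos (C := C + C + 2 * C) (by fun_prop) (fun t => ?_) hs
    (fun t _ => by linarith [hmin (x + t), hmin (x - t)]) ?_)
  · have h3 : |2 * f x| ≤ 2 * C := by rw [abs_mul, abs_two]; gcongr; exact hC x
    exact (abs_sub _ _).trans (add_le_add ((abs_add_le _ _).trans (add_le_add (hC _) (hC _))) h3)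
  -- If the second difference vanished for all `t ≥ 0`, its two nonnegative summands `f(x ± t) -
  -- f(x)` would vanish, and `f` would be constant.
  · by_contra! h
    refine hconst ⟨f x, fun y => ?_⟩
    have h1 := h |y - x| (abs_nonneg _)
    have h2 := hmin (x + |y - x|)
    have h3 := hmin (x - |y - x|)
    rcases abs_choice (y - x) with h4 | h4 <;> rw [h4] at h1 h2 h3
    · rw [add_sub_cancel] at h1 h2; linarith
    · rw [sub_neg_eq_add, add_sub_cancel] at h1 h3; linarith

/-! ### The periodised kernel -/

lemma one_sub_exp_neg_pos {s P : ℝ} (hs : 0 < s) (hP : 0 < P) : 0 < 1 - Real.exp (-(s * P)) := by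
  have : 0 < s * P := by positivity
  have := Real.exp_lt_one_iff.2 (neg_lt_zero.2 this)
  linarith

/-- The one-sided periodisation `∑_{n ≥ 0} K(y + n P)`, in closed form. -/
def halfPeriodicKernel (P y : ℝ) : ℝ :=
  ∫ s in Ioi 0, density s * (Real.exp (-(s * y)) / (1 - Real.exp (-(s * P))))

lemma hasSum_laplaceKernel {P y : ℝ} (hP : 0 < P) (hy : 0 < y) :
    HasSum (fun n : ℕ => laplaceKernel (y + n * P)) (halfPeriodicKernel P y) := by
  have hn : ∀ n : ℕ, 0 < y + n * P := fun n => by positivity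
  have hnorm : ∀ (n : ℕ) (s : ℝ), ‖density s * Real.exp (-(s * (y + n * P)))‖ =
      density s * Real.exp (-(s * (y + n * P))) := fun n s =>
    Real.norm_of_nonneg (mul_nonneg (density_nonneg s) (Real.exp_pos _).le)
  have hsplit : ∀ (n : ℕ) (s : ℝ), Real.exp (-(s * (y + n * P))) =
      Real.exp (-(s * y)) * Real.exp (-(s * P)) ^ n := fun n s => by
    rw [← Real.exp_nat_mul, ← Real.exp_add]; ring_nf
  have h := hasSum_integral_of_summable_integral_norm (μ := volume.restrict (Ioi 0))
    (F := fun (n : ℕ) s => density s * Real.exp (-(s * (y + n * P))))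
    (fun n => integrableOn_density_mul_exp (hn n)) ?_
  · have hsum : halfPeriodicKernel P y =
        ∫ s in Ioi 0, ∑' n : ℕ, density s * Real.exp (-(s * (y + n * P))) := by
      refine setIntegral_congr_fun measurableSet_Ioi fun s hs => ?_
      have h1 := one_sub_exp_neg_pos hs hP
      have hlt : Real.exp (-(s * P)) < 1 := by linarith
      have h2 := hasSum_geometric_of_lt_one (Real.exp_pos (-(s * P))).le hlt
      simp only [hsplit]
      rw [tsum_mul_left, tsum_mul_left, h2.tsum_eq, div_eq_mul_inv]
    rw [hsum]
    exact h
  · simp only [hnorm]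
    -- The density lives on `s > 1`, where `exp(-snP) ≤ exp(-nP)`.
    have hg : Summable fun n : ℕ => laplaceKernel y * Real.exp (-P) ^ n :=
      (summable_geometric_of_lt_one (Real.exp_pos _).le
        (Real.exp_lt_one_iff.2 (neg_lt_zero.2 hP))).mul_left _
    refine hg.of_nonneg_of_le (fun n => ?_) fun n => ?_
    · exact integral_nonneg fun s => mul_nonneg (density_nonneg s) (Real.exp_pos _).le
    · rw [laplaceKernel, ← integral_mul_const]
      refine setIntegral_mono_on (integrableOn_density_mul_exp (hn n))
        ((integrableOn_density_mul_exp hy).mul_const _) measurableSet_Ioi fun s hs => ?_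
      rcases le_or_gt s 1 with h1 | h1
      · simp [density_eq_zero hs h1]
      · have hd := density_nonneg s
        rw [hsplit, ← mul_assoc]
        gcongr
        nlinarith

/-- From `exp u ≥ u²/2` at `u = sy`; the result has the `O(1/s)` size that is integrable against the
density. -/
lemma mul_exp_div_le {P y s : ℝ} (hP : 0 < P) (hy : 0 < y) (hs : 1 < s) :
    s * Real.exp (-(s * y)) / (1 - Real.exp (-(s * P))) ≤
      (2 / y ^ 2 / (1 - Real.exp (-P))) / s := by
  have hs0 : 0 < s := by linarith
  have h1 : 0 < 1 - Real.exp (-P) := by simpa using one_sub_exp_neg_pos one_pos hP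
  have h2 : 1 - Real.exp (-P) ≤ 1 - Real.exp (-(s * P)) := by
    have : Real.exp (-(s * P)) ≤ Real.exp (-P) := Real.exp_le_exp.2 (by nlinarith)
    linarith
  have h3 : s * Real.exp (-(s * y)) ≤ 2 / y ^ 2 / s := by
    have := Real.quadratic_le_exp_of_nonneg (x := s * y) (by positivity)
    rw [Real.exp_neg, ← div_eq_mul_inv, div_div, div_le_div_iff₀ (Real.exp_pos _) (by positivity)]
    have h4 : 0 < s * y := by positivity
    nlinarith
  calc _ ≤ (2 / y ^ 2 / s) / (1 - Real.exp (-P)) := by gcongr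
    _ = _ := by field_simp

lemma integrableOn_density_mul_exp_div {P y : ℝ} (hP : 0 < P) (hy : 0 < y) :
    IntegrableOn (fun s => density s * (s * Real.exp (-(s * y)) / (1 - Real.exp (-(s * P)))))
      (Ioi 0) :=
  integrableOn_density_mul (Measurable.aestronglyMeasurable (by fun_prop)) fun s hs => by
    have := one_sub_exp_neg_pos (s := s) (by linarith) hP
    rw [abs_of_nonneg (by positivity)]
    exact mul_exp_div_le hP hy hs

lemma hasDerivAt_halfPeriodicKernel {P y : ℝ} (hP : 0 < P) (hy : 0 < y) :
    HasDerivAt (halfPeriodicKernel P)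
      (-∫ s in Ioi 0, density s * (s * Real.exp (-(s * y)) / (1 - Real.exp (-(s * P))))) y := by
  rw [← integral_neg]
  have h1P : 0 < 1 - Real.exp (-P) := by simpa using one_sub_exp_neg_pos one_pos hP
  refine (hasDerivAt_integral_of_dominated_loc_of_deriv_le (s := Ioi (y / 2))
    (F' := fun z s => -(density s * (s * Real.exp (-(s * z)) / (1 - Real.exp (-(s * P))))))
    (bound := fun s => (2 / (y / 2) ^ 2 / (1 - Real.exp (-P))) * (density s / s))
    (Ioi_mem_nhds (by linarith)) (.of_forall fun z => ?_) ?_ ?_ ?_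
    (integrableOn_density_div.const_mul _) ?_).2
  · exact (measurable_density.mul (by fun_prop)).aestronglyMeasurable
  · refine integrableOn_density_mul (C := 1 / y / (1 - Real.exp (-P)))
      (Measurable.aestronglyMeasurable (by fun_prop)) fun s hs => ?_
    have h0 : 0 < s := by linarith
    have h1 := one_sub_exp_neg_pos h0 hP
    have h2 : 1 - Real.exp (-P) ≤ 1 - Real.exp (-(s * P)) := by
      have : Real.exp (-(s * P)) ≤ Real.exp (-P) := Real.exp_le_exp.2 (by nlinarith)
      linarith
    rw [abs_of_nonneg (by positivity)]
    calc _ ≤ (1 / y / s) / (1 - Real.exp (-P)) := by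
          gcongr; exact mul_exp_neg_le hy h0
      _ = _ := by field_simp
  · exact (integrableOn_density_mul_exp_div hP hy).neg.aestronglyMeasurable
  · refine (ae_restrict_iff' measurableSet_Ioi).2 (.of_forall fun s hs z hz => ?_)
    have h0 : 0 < s := hs
    have hz' : y / 2 < z := hz
    have h1 := one_sub_exp_neg_pos h0 hP
    have hd := density_nonneg s
    rw [norm_neg, Real.norm_of_nonneg (by positivity)]
    rcases le_or_gt s 1 with h2 | h2
    · simp [density_eq_zero h0 h2]
    · have := mul_exp_div_le hP (half_pos hy) h2
      calc _ ≤ density s * (s * Real.exp (-(s * (y / 2))) / (1 - Real.exp (-(s * P)))) := by gcongr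
        _ ≤ density s * ((2 / (y / 2) ^ 2 / (1 - Real.exp (-P))) / s) := by gcongr
        _ = _ := by ring
  · refine .of_forall fun s z _ => ?_
    have := ((((hasDerivAt_id z).const_mul s).neg).exp.div_const
      (1 - Real.exp (-(s * P)))).const_mul (density s)
    refine this.congr_deriv ?_
    simp; ring

/-- The terms `n ≥ 0` lie at distances `x + nP` from the origin, the terms `n < 0` at distances `(P
- x) + nP` with `n ≥ 0`. -/
lemma periodicKernel_eq {P x : ℝ} (hx0 : 0 < x) (hxP : x < P) :
    periodicKernel P x = halfPeriodicKernel P x + halfPeriodicKernel P (P - x) := by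
  have hP : 0 < P := by linarith
  refine HasSum.tsum_eq (HasSum.of_nat_of_neg_add_one ?_ ?_)
  · convert hasSum_laplaceKernel hP hx0 using 2 with n
    have : 0 < x + n * P := by positivity
    rw [Int.cast_natCast, kernel_eq this.ne', abs_of_pos this]
  · convert hasSum_laplaceKernel hP (sub_pos.2 hxP) using 2 with n
    have h1 : 0 < P - x + n * P := by
      have : 0 ≤ n * P := by positivity
      linarith
    have h2 : x + ((-(n + 1) : ℤ) : ℝ) * P = -(P - x + n * P) := by push_cast; ring
    rw [h2, kernel_eq (by linarith), abs_neg, abs_of_pos h1]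

/-- The number `-K_P'(P / 4)`. -/
def quarterSlope (P : ℝ) : ℝ :=
  ∫ s in Ioi 0, density s *
    (s * (Real.exp (-(s * (P / 4))) - Real.exp (-(s * (3 * P / 4)))) / (1 - Real.exp (-(s * P))))

lemma integrableOn_quarterSlope {P : ℝ} (hP : 0 < P) : IntegrableOn (fun s => density s *
    (s * (Real.exp (-(s * (P / 4))) - Real.exp (-(s * (3 * P / 4)))) / (1 - Real.exp (-(s * P)))))
    (Ioi 0) := by
  refine ((integrableOn_density_mul_exp_div hP (y := P / 4) (by positivity)).sub
    (integrableOn_density_mul_exp_div hP (y := 3 * P / 4) (by positivity))).congr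
    (.of_forall fun s => ?_)
  simp only [Pi.sub_apply]; ring

lemma quarterSlope_nonneg {P : ℝ} (hP : 0 < P) : 0 ≤ quarterSlope P := by
  refine setIntegral_nonneg measurableSet_Ioi fun s hs => ?_
  have h0 : 0 < s := hs
  have h1 := one_sub_exp_neg_pos h0 hP
  have hd := density_nonneg s
  have h2 : Real.exp (-(s * (3 * P / 4))) ≤ Real.exp (-(s * (P / 4))) :=
    Real.exp_le_exp.2 (by nlinarith)
  have h3 := sub_nonneg.2 h2
  positivity

lemma hasDerivAt_periodicKernel {P : ℝ} (hP : 0 < P) :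
    HasDerivAt (periodicKernel P) (-quarterSlope P) (P / 4) := by
  have h1 := hasDerivAt_halfPeriodicKernel hP (y := P / 4) (by positivity)
  have h2 := hasDerivAt_halfPeriodicKernel hP (y := P - P / 4) (by linarith)
  have h3 := h1.add (h2.comp_const_sub P (P / 4))
  refine (h3.congr_deriv ?_).congr_of_eventuallyEq ?_
  · have e : P - P / 4 = 3 * P / 4 := by ring
    rw [e, neg_neg, ← sub_eq_neg_add, quarterSlope, ← neg_sub, ← integral_sub
      (integrableOn_density_mul_exp_div hP (by positivity))
      (integrableOn_density_mul_exp_div hP (by positivity))]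
    congr 2; funext s; ring
  · filter_upwards [Ioo_mem_nhds (a := 0) (b := P) (x := P / 4) (by positivity) (by linarith)]
      with x hx
    exact periodicKernel_eq hx.1 hx.2

lemma integral_exp_neg_interval {s : ℝ} (hs : 0 < s) (a b : ℝ) :
    ∫ t in a..b, Real.exp (-(s * t)) = (Real.exp (-(s * a)) - Real.exp (-(s * b))) / s := by
  have : ∀ t ∈ uIcc a b, HasDerivAt (fun t => -(Real.exp (-(s * t)) / s)) (Real.exp (-(s * t))) t := by
    intro t _
    refine ((((hasDerivAt_id t).const_mul s).neg).exp.div_const s).neg.congr_deriv ?_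
    simp; field_simp
  rw [intervalIntegral.integral_eq_sub_of_hasDerivAt this
    (Continuous.intervalIntegrable (by fun_prop) _ _)]
  ring

/-- A quantitative lower bound for `L f''` at a minimum of a periodic function `f`. -/
lemma le_L_second_deriv {f f' f'' : ℝ → ℝ} {C C' C'' P c x : ℝ}
    (hd : ∀ t, HasDerivAt f (f' t) t)
    (hd' : ∀ t, HasDerivAt f' (f'' t) t) (hc'' : Continuous f'') (hC : ∀ t, |f t| ≤ C)
    (hC' : ∀ t, |f' t| ≤ C') (hC'' : ∀ t, |f'' t| ≤ C'') (hP : 0 < P)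
    (hper : Function.Periodic f P) (hmin : ∀ y, f x ≤ f y)
    (hlow : ∀ t ∈ Icc (P / 4) (3 * P / 4), 2 * c ≤ f (x + t) + f (x - t)) :
    2 * (c - f x) * quarterSlope P ≤ L f'' x := by
  have hc : Continuous f := continuous_iff_continuousAt.2 fun t => (hd t).continuousAt
  rw [L_eq_integral_laplace hc'' hC'', quarterSlope, ← integral_const_mul]
  refine setIntegral_mono_on ((integrableOn_quarterSlope hP).const_mul _)
    (integrableOn_density_mul_laplace (C := C'' + C'') (by fun_prop) fun t =>
      (abs_add_le _ _).trans (add_le_add (hC'' _) (hC'' _))) measurableSet_Ioi fun s hs => ?_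
  have hs0 : 0 < s := hs
  rw [laplace_second_deriv hd hd' hc'' hC hC' hC'' x hs, mul_left_comm]
  refine mul_le_mul_of_nonneg_left ?_ (density_nonneg s)
  set D : ℝ → ℝ := fun t => f (x + t) + f (x - t) - 2 * f x with hD
  have hDc : Continuous D := by fun_prop
  have hDb : ∀ t, |D t| ≤ C + C + 2 * C := fun t => by
    have h3 : |2 * f x| ≤ 2 * C := by rw [abs_mul, abs_two]; gcongr; exact hC x
    exact (abs_sub _ _).trans (add_le_add ((abs_add_le _ _).trans (add_le_add (hC _) (hC _))) h3)
  have hDp : Function.Periodic D P := fun t => by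
    have h1 : f (x + (t + P)) = f (x + t) := by rw [← add_assoc]; exact hper _
    have h2 : f (x - (t + P)) = f (x - t) := by rw [← sub_sub]; exact hper.sub_eq _
    simp only [hD, h1, h2]
  have hDn : ∀ t, 0 ≤ D t := fun t => by
    have := hmin (x + t); have := hmin (x - t); simp only [hD]; linarith
  have h1 := one_sub_exp_neg_pos hs0 hP
  have hlap := laplace_periodic hDc hDb hs0 hP hDp
  have hE : Continuous fun t => Real.exp (-(s * t)) * D t := by fun_prop
  have hEn : ∀ t, 0 ≤ Real.exp (-(s * t)) * D t := fun t =>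
    mul_nonneg (Real.exp_pos _).le (hDn t)
  -- Only the middle half of the period is kept, `D` being nonnegative elsewhere. Integrating the
  -- exponential there reproduces, after the factor `s²`, the integrand of `quarterSlope`.
  have h2 : ∫ t in (P / 4)..(3 * P / 4), Real.exp (-(s * t)) * (2 * (c - f x)) ≤
      ∫ t in 0..P, Real.exp (-(s * t)) * D t := by
    calc _ ≤ ∫ t in (P / 4)..(3 * P / 4), Real.exp (-(s * t)) * D t := by
          refine intervalIntegral.integral_mono_on (by linarith)
            (Continuous.intervalIntegrable (by fun_prop) _ _) (hE.intervalIntegrable _ _)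
            fun t ht => mul_le_mul_of_nonneg_left ?_ (Real.exp_pos _).le
          have := hlow t ht
          simp only [hD]; linarith
      _ ≤ _ := intervalIntegral.integral_mono_interval (by positivity) (by linarith) (by linarith)
          (.of_forall hEn) (hE.intervalIntegrable _ _)
  rw [intervalIntegral.integral_mul_const, integral_exp_neg_interval hs0, ← hlap] at h2
  have h4 : (Real.exp (-(s * (P / 4))) - Real.exp (-(s * (3 * P / 4)))) / s * (2 * (c - f x)) /
      (1 - Real.exp (-(s * P))) ≤ laplace D s := by
    rw [div_le_iff₀ h1]; linarith
  calc _ = s ^ 2 * ((Real.exp (-(s * (P / 4))) - Real.exp (-(s * (3 * P / 4)))) / s *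
        (2 * (c - f x)) / (1 - Real.exp (-(s * P)))) := by field_simp
    _ ≤ _ := by gcongr

/-! ### Even functions that are monotone on a half period -/

lemma mem_leftHalfPeriod_coe {p x : ℝ} :
    x ∈ leftHalfPeriod (p : EReal) ↔ -(p / 2) < x ∧ x < 0 := by
  have h : -((p : EReal) / 2) = ((-(p / 2) : ℝ) : EReal) := by push_cast; rfl
  rw [leftHalfPeriod, mem_ofPred_eq, h, EReal.coe_lt_coe_iff]

lemma mem_leftHalfPeriod_top {x : ℝ} : x ∈ leftHalfPeriod ⊤ ↔ x < 0 := by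
  have h : (⊤ : EReal) / 2 = ⊤ := EReal.top_div_of_pos_ne_top (by norm_num) (by decide)
  simp [leftHalfPeriod, h]

section Shape

variable {φ : ℝ → ℝ} {p : ℝ}

lemma le_of_abs_le (hc : Continuous φ) (heven : Function.Even φ) (hp : 0 < p)
    (hmono : MonotoneOn φ (Ioo (-(p / 2)) 0)) {u v : ℝ} (huv : |u| ≤ |v|) (hv : |v| ≤ p / 2) :
    φ v ≤ φ u := by
  have habs : ∀ w, φ w = φ (-|w|) := fun w => by
    rcases abs_choice w with h | h <;> rw [h]
    · exact (heven w).symm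
    · rw [neg_neg]
  -- Monotonicity must be extended to the closed half period. Written with `max` it holds on a full
  -- product of intervals and is a closed condition, so it passes to the closure.
  have hcl : IsClosed {q : ℝ × ℝ | φ q.1 ≤ φ (max q.1 q.2)} :=
    isClosed_le (by fun_prop) (by fun_prop)
  have hsub : Ioo (-(p / 2)) 0 ×ˢ Ioo (-(p / 2)) 0 ⊆ {q : ℝ × ℝ | φ q.1 ≤ φ (max q.1 q.2)} :=
    fun q hq => hmono hq.1 ⟨lt_max_of_lt_left hq.1.1, max_lt hq.1.2 hq.2.2⟩ (le_max_left _ _)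
  have h := closure_minimal hsub hcl
  rw [closure_prod_eq, closure_Ioo (by linarith)] at h
  have h1 := @h (-|v|, -|u|) ⟨⟨by simpa using hv, by simp⟩,
    ⟨by simpa using huv.trans hv, by simp⟩⟩
  rw [mem_ofPred_eq] at h1
  dsimp only at h1
  rw [max_eq_right (neg_le_neg huv)] at h1
  rwa [habs v, habs u]

lemma Periodic.exists_abs_le (hper : Function.Periodic φ p) (hp : 0 < p) (x : ℝ) :
    ∃ y, |y| ≤ p / 2 ∧ φ x = φ y := by
  obtain ⟨y, hy, hxy⟩ := hper.exists_mem_Ico hp x (-(p / 2))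
  exact ⟨y, abs_le.2 ⟨hy.1, by linarith [hy.2]⟩, hxy⟩

/-- An even periodic function that is monotone on a half period and has another period smaller
than half of the given one is constant. -/
lemma eq_const_of_periodic (hc : Continuous φ) (heven : Function.Even φ) (hp : 0 < p)
    (hmono : MonotoneOn φ (Ioo (-(p / 2)) 0)) {c : ℝ} (hc0 : 0 < c) (hcp : c ≤ p / 2)
    (hper : Function.Periodic φ c) (x : ℝ) : φ x = φ 0 := by
  obtain ⟨y, hy, hxy⟩ := hper.exists_mem_Ico hc0 x 0
  rw [zero_add] at hy
  have hy' : |y| ≤ |c| := by rw [abs_of_nonneg hy.1, abs_of_pos hc0]; exact hy.2.le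
  have hc' : |c| ≤ p / 2 := by rwa [abs_of_pos hc0]
  -- On `[0, c]` the function is squeezed: `φ c ≤ φ y ≤ φ 0 = φ c`.
  have h1 := le_of_abs_le hc heven hp hmono hy' hc'
  have h2 := le_of_abs_le hc heven hp hmono (u := 0) (v := y) (by simp) (hy'.trans hc')
  have h3 : φ c = φ 0 := by simpa using hper 0
  rw [hxy]; linarith

/-- The reflections about `x` and about `0` compose to a translation by `2x`. -/
lemma periodic_of_reflection (heven : Function.Even φ) {x : ℝ}
    (h : ∀ t, φ (x + t) = φ (x - t)) : Function.Periodic φ (-(2 * x)) := fun u => by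
  have := h (x - u)
  rw [sub_sub_cancel] at this
  rw [← this, ← heven]
  congr 1; ring

/-- For `x < 0 < t` the point `x + t` is nearer to `0` than `x - t`, so the difference is
nonnegative. If it vanished identically, `φ` would be symmetric about `x`, hence periodic, hence
constant. The finite lengths `p` below are auxiliary, chosen just large enough. -/
lemma laplace_diff_pos_of_monotone {C x s : ℝ} (hc : Continuous φ) (hC : ∀ t, |φ t| ≤ C)
    (heven : Function.Even φ) (hmono : MonotoneOn φ (Iio 0)) (hconst : ¬ ∃ c, ∀ y, φ y = c)
    (hx : x < 0) (hs : 0 < s) : 0 < laplace (fun t => φ (x + t) - φ (x - t)) s := by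
  have hmono' : ∀ p, MonotoneOn φ (Ioo (-(p / 2)) 0) := fun p => hmono.mono fun y hy => hy.2
  refine laplace_pos (C := C + C) (by fun_prop)
    (fun t => (abs_sub _ _).trans (add_le_add (hC _) (hC _))) hs (fun t ht => ?_) ?_
  · have h1 : |x + t| ≤ |x - t| := by
      rw [abs_of_neg (by linarith : x - t < 0), abs_le]
      constructor <;> linarith
    exact sub_nonneg.2 (le_of_abs_le hc heven (p := 2 * |x - t|)
      (by rw [abs_of_neg (by linarith : x - t < 0)]; linarith) (hmono' _) h1 (by linarith))
  · by_contra! h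
    refine hconst ⟨φ 0, eq_const_of_periodic hc heven (p := 2 * (-(2 * x))) (by linarith)
      (hmono' _) (c := -(2 * x)) (by linarith) (by linarith)
      (periodic_of_reflection heven fun t => ?_)⟩
    rcases le_total 0 t with h1 | h1
    · linarith [h t h1]
    · have := h (-t) (by linarith)
      rw [sub_neg_eq_add, ← sub_eq_add_neg] at this
      linarith

/-- The difference `D` is antisymmetric about `p/2` and nonnegative on `[0, p/2]`. Folding one
period at `p/2` therefore gives `D` the weight `exp(-st) - exp(-s(p-t))`, positive for `t < p/2`. -/
lemma laplace_diff_pos_of_periodic {C x s : ℝ} (hc : Continuous φ) (hC : ∀ t, |φ t| ≤ C)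
    (heven : Function.Even φ) (hp : 0 < p) (hper : Function.Periodic φ p)
    (hmono : MonotoneOn φ (Ioo (-(p / 2)) 0)) (hconst : ¬ ∃ c, ∀ y, φ y = c)
    (hxp : -(p / 2) < x) (hx : x < 0) (hs : 0 < s) :
    0 < laplace (fun t => φ (x + t) - φ (x - t)) s := by
  set D : ℝ → ℝ := fun t => φ (x + t) - φ (x - t) with hD
  have hDc : Continuous D := by fun_prop
  have hDper : Function.Periodic D p := fun t => by
    have h1 : φ (x + (t + p)) = φ (x + t) := by rw [← add_assoc]; exact hper _
    have h2 : φ (x - (t + p)) = φ (x - t) := by rw [← sub_sub]; exact hper.sub_eq _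
    simp only [hD, h1, h2]
  have hDneg : ∀ t, D (-t) = -D t := fun t => by
    simp only [hD, sub_neg_eq_add, ← sub_eq_add_neg]; ring
  have hDanti : ∀ t, D (p - t) = -D t := fun t => by
    rw [← hDneg, sub_eq_neg_add]; exact hDper _
  have hDnonneg : ∀ t ∈ Icc 0 (p / 2), 0 ≤ D t := fun t ht => by
    refine sub_nonneg.2 ?_
    rcases le_total (t - x) (p / 2) with h | h
    · have h0 : |x - t| = t - x := by rw [abs_sub_comm]; exact abs_of_pos (by linarith [ht.1])
      refine le_of_abs_le hc heven hp hmono ?_ (h0 ▸ h)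
      rw [h0, abs_le]
      constructor <;> linarith [ht.1]
    -- Here `x - t` has left the central period; its translate by `p` is still farther from `0` than
    -- `x + t`.
    · have h0 : |x - t + p| = x - t + p := abs_of_pos (by linarith [ht.2])
      rw [← hper (x - t)]
      refine le_of_abs_le hc heven hp hmono ?_ (by rw [h0]; linarith)
      rw [h0, abs_le]
      constructor <;> linarith [ht.2]
  have hex : ∃ t ∈ Icc 0 (p / 2), D t ≠ 0 := by
    by_contra! h
    have hzero : ∀ t, D t = 0 := fun t => by
      obtain ⟨y, hy, hty⟩ := hDper.exists_mem_Ico hp t 0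
      rw [zero_add] at hy
      rw [hty]
      rcases le_total y (p / 2) with h1 | h1
      · exact h y ⟨hy.1, h1⟩
      · have h2 := h (p - y) ⟨by linarith [hy.2], by linarith⟩
        rw [hDanti] at h2
        linarith
    have hper2 := periodic_of_reflection heven (x := x) fun t => sub_eq_zero.1 (hzero t)
    -- Both `-2x` and `p + 2x` are periods, and one of them is at most `p/2`.
    rcases le_total (-(2 * x)) (p / 2) with h1 | h1
    · exact hconst ⟨_, eq_const_of_periodic hc heven hp hmono (by linarith) h1 hper2⟩
    · exact hconst ⟨_, eq_const_of_periodic hc heven hp hmono (c := p - -(2 * x)) (by linarith)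
        (by linarith) (hper.sub_period hper2)⟩
  obtain ⟨c, hc0, hcD⟩ := hex
  have hlap := laplace_periodic hDc (C := C + C)
    (fun t => (abs_sub _ _).trans (add_le_add (hC _) (hC _))) hs hp hDper
  have hE : Continuous fun t => Real.exp (-(s * t)) * D t := by fun_prop
  have h1 : ∫ t in (p / 2)..p, Real.exp (-(s * t)) * D t =
      ∫ t in 0..(p / 2), Real.exp (-(s * (p - t))) * -D t := by
    have := intervalIntegral.integral_comp_sub_left (a := 0) (b := p / 2)
      (fun t => Real.exp (-(s * t)) * D t) p
    rw [sub_zero, sub_half] at this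
    rw [← this]
    simp only [hDanti]
  rw [← intervalIntegral.integral_add_adjacent_intervals (hE.intervalIntegrable 0 (p / 2))
    (hE.intervalIntegrable (p / 2) p), h1, ← intervalIntegral.integral_add
    (hE.intervalIntegrable _ _) (Continuous.intervalIntegrable (by fun_prop) _ _)] at hlap
  have hw : ∀ t, Real.exp (-(s * t)) * D t + Real.exp (-(s * (p - t))) * -D t =
      (Real.exp (-(s * t)) - Real.exp (-(s * (p - t)))) * D t := fun t => by ring
  simp only [hw] at hlap
  have hpos : 0 < ∫ t in 0..(p / 2), (Real.exp (-(s * t)) - Real.exp (-(s * (p - t)))) * D t := by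
    refine intervalIntegral.integral_pos (by linarith) (by fun_prop) (fun t ht => ?_) ⟨c, hc0, ?_⟩
    · refine mul_nonneg (sub_nonneg.2 (Real.exp_le_exp.2 ?_)) (hDnonneg t ⟨ht.1.le, ht.2⟩)
      nlinarith [ht.2]
    · refine mul_pos (sub_pos.2 (Real.exp_lt_exp.2 ?_)) (lt_of_le_of_ne (hDnonneg c hc0) hcD.symm)
      -- Antisymmetry forces `D (p/2) = 0`, so `c` lies where the weight is strictly positive.
      have hne : c ≠ p / 2 := by
        rintro rfl
        have := hDanti (p / 2)
        rw [sub_half] at this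
        exact hcD (by linarith)
      have : c < p / 2 := lt_of_le_of_ne hc0.2 hne
      nlinarith
  rw [← hlap] at hpos
  exact (mul_pos_iff_of_pos_left (one_sub_exp_neg_pos hs hp)).1 hpos

end Shape

/-! ### Solutions -/

section Solution

variable {μ C C' C'' : ℝ} {φ φ' φ'' : ℝ → ℝ}

lemma IsSolution.L_eq (h : IsSolution μ φ) (x : ℝ) : L φ x = φ x * (μ - φ x) := by
  linarith [h.equation x]

/-- `Lφ = φ(μ - φ)` is differentiated in two ways, and the derivatives are compared. -/
lemma IsSolution.deriv_eq (h : IsSolution μ φ) (hd : ∀ t, HasDerivAt φ (φ' t) t)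
    (hc' : Continuous φ') (hC : ∀ t, |φ t| ≤ C) (hC' : ∀ t, |φ' t| ≤ C') (x : ℝ) :
    L φ' x = (μ - 2 * φ x) * φ' x := by
  have h1 := hasDerivAt_L hd hc' hC hC' x
  rw [funext h.L_eq] at h1
  exact h1.unique (((hd x).mul ((hd x).const_sub μ)).congr_deriv (by ring))

lemma IsSolution.second_deriv_eq (h : IsSolution μ φ) (hd : ∀ t, HasDerivAt φ (φ' t) t)
    (hd' : ∀ t, HasDerivAt φ' (φ'' t) t) (hc'' : Continuous φ'')
    (hC : ∀ t, |φ t| ≤ C) (hC' : ∀ t, |φ' t| ≤ C') (hC'' : ∀ t, |φ'' t| ≤ C'') (x : ℝ) :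
    L φ'' x = (μ - 2 * φ x) * φ'' x - 2 * φ' x ^ 2 := by
  have hc' : Continuous φ' := continuous_iff_continuousAt.2 fun t => (hd' t).continuousAt
  have h1 := hasDerivAt_L hd' hc'' hC' hC'' x
  rw [funext (h.deriv_eq hd hc' hC hC')] at h1
  refine h1.unique (((((hd x).const_mul 2).const_sub μ).mul (hd' x)).congr_deriv ?_)
  ring

/-- A nonconstant solution that attains its supremum, with `φ ≤ μ / 2`, has positive speed. -/
lemma IsSolution.speed_pos (h : IsSolution μ φ) (hC : ∀ t, |φ t| ≤ C) {x₀ : ℝ}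
    (hmax : ∀ x, φ x ≤ φ x₀) (hμ : φ x₀ ≤ μ / 2) (hconst : ¬ ∃ c, ∀ y, φ y = c) : 0 < μ := by
  by_contra! hμ0
  have hc := h.continuous
  have hneg : L φ x₀ < 0 := by
    have hn : ∀ t, 0 ≤ -φ t := fun t => by linarith [hmax t]
    have := L_pos hc.neg (fun t => (abs_neg (φ t)).le.trans (hC t)) hn ?_ x₀
    · have h2 := L_neg φ x₀
      change 0 < L (fun t => -φ t) x₀ at this
      linarith
    · by_contra! h0
      exact hconst ⟨0, fun y => neg_eq_zero.1 (h0 y)⟩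
  have hle := L_le_of_le hc hC hmax x₀
  rw [h.L_eq] at hneg hle
  have hM0 : φ x₀ < 0 := by
    refine lt_of_le_of_ne (by linarith) fun h0 => ?_
    rw [h0] at hneg; simp at hneg
  -- With `M = φ x₀ < 0`, divide `M(μ - M) ≤ M` by `M`.
  have hM1 : 1 ≤ μ - φ x₀ := by nlinarith
  set m := sInf (range φ) with hm
  have hbdd : BddBelow (range φ) := ⟨-C, by rintro _ ⟨t, rfl⟩; exact (abs_le.1 (hC t)).1⟩
  have hml : ∀ t, m ≤ φ t := fun t => csInf_le hbdd ⟨t, rfl⟩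
  -- The infimum need not be attained, so the inequality `m ≤ Lφ`, valid at every value of `φ`, is
  -- carried to the closure of the range. Division by `m < 0` gives `μ - m ≤ 1 ≤ μ - M`, hence `m ≥
  -- M`.
  have hmcl : m ∈ {v : ℝ | m ≤ v * (μ - v)} := by
    refine closure_minimal ?_ (isClosed_le (by fun_prop) (by fun_prop))
      (csInf_mem_closure (range_nonempty φ) hbdd)
    rintro _ ⟨t, rfl⟩
    rw [mem_ofPred_eq, ← h.L_eq]
    exact le_L_of_le hc hC hml t
  rw [mem_ofPred_eq] at hmcl
  have hm0 : m < 0 := (hml x₀).trans_lt hM0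
  have hm1 : μ - m ≤ 1 := by nlinarith
  exact hconst ⟨φ x₀, fun y => le_antisymm (hmax y) (by linarith [hml y])⟩

/-- A solution with speed at most `1` has a nonpositive minimum. -/
lemma IsSolution.min_nonpos (h : IsSolution μ φ) (hC : ∀ t, |φ t| ≤ C) {x₀ : ℝ}
    (hmin : ∀ x, φ x₀ ≤ φ x) (hμ : μ ≤ 1) : φ x₀ ≤ 0 := by
  by_contra! h0
  have := le_L_of_le h.continuous hC hmin x₀
  rw [h.L_eq] at this
  nlinarith

end Solution

/-! ### Derivatives of `BUC` functions, and the half period for finite and infinite `P`. -/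

lemma BUC.hasDerivAt {φ : ℝ → ℝ} (h : BUC 1 φ) (x : ℝ) : HasDerivAt φ (deriv φ x) x :=
  (h.1.differentiable (by norm_num) x).hasDerivAt

lemma BUC.continuous_deriv {φ : ℝ → ℝ} (h : BUC 1 φ) : Continuous (deriv φ) := by
  have := (h.2 1 le_rfl).1.continuous
  rwa [iteratedDeriv_one] at this

lemma BUC.bounded_deriv {φ : ℝ → ℝ} (h : BUC 1 φ) : ∃ C, ∀ x, |deriv φ x| ≤ C := by
  simpa [iteratedDeriv_one] using (h.2 1 le_rfl).2

lemma BUC.hasDerivAt_deriv {φ : ℝ → ℝ} (h : BUC 2 φ) (x : ℝ) :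
    HasDerivAt (deriv φ) (iteratedDeriv 2 φ x) x := by
  have h1 : Differentiable ℝ (iteratedDeriv 1 φ) :=
    h.1.differentiable_iteratedDeriv 1 (by norm_num)
  rw [iteratedDeriv_one] at h1
  have h2 : iteratedDeriv 2 φ = deriv (deriv φ) := by
    rw [iteratedDeriv_succ, iteratedDeriv_one]
  rw [h2]
  exact (h1 x).hasDerivAt

lemma laplace_diff_pos {φ : ℝ → ℝ} {C : ℝ} {P : EReal} (hP : 0 < P) (hc : Continuous φ)
    (hC : ∀ t, |φ t| ≤ C) (heven : Function.Even φ) (hper : IsPeriodic P φ)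
    (hmono : MonotoneOn φ (leftHalfPeriod P)) (hconst : ¬ ∃ c, ∀ y, φ y = c)
    {x s : ℝ} (hx : x ∈ leftHalfPeriod P) (hs : 0 < s) :
    0 < laplace (fun t => φ (x + t) - φ (x - t)) s := by
  induction P with
  | bot => simp at hP
  | top =>
    refine laplace_diff_pos_of_monotone hc hC heven (hmono.mono fun y hy => ?_) hconst
      (mem_leftHalfPeriod_top.1 hx) hs
    exact mem_leftHalfPeriod_top.2 hy
  | coe p =>
    rw [mem_leftHalfPeriod_coe] at hx
    exact laplace_diff_pos_of_periodic hc hC heven (EReal.coe_pos.1 hP) (hper p rfl)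
      (hmono.mono fun y hy => mem_leftHalfPeriod_coe.2 hy) hconst hx.1 hx.2 hs

lemma le_apply_zero {φ : ℝ → ℝ} {P : EReal} (hP : 0 < P) (hc : Continuous φ)
    (heven : Function.Even φ) (hper : IsPeriodic P φ)
    (hmono : MonotoneOn φ (leftHalfPeriod P)) (x : ℝ) : φ x ≤ φ 0 := by
  induction P with
  | bot => simp at hP
  | top =>
    refine le_of_abs_le hc heven (p := 2 * (|x| + 1)) (by positivity) (hmono.mono fun y hy => ?_)
      (by simp) (by linarith)
    exact mem_leftHalfPeriod_top.2 hy.2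
  | coe p =>
    have hp := EReal.coe_pos.1 hP
    obtain ⟨y, hy, hxy⟩ := Periodic.exists_abs_le (hper p rfl) hp x
    rw [hxy]
    exact le_of_abs_le hc heven hp (hmono.mono fun y hy => mem_leftHalfPeriod_coe.2 hy)
      (by simp) hy

lemma isOpen_leftHalfPeriod (P : EReal) : IsOpen (leftHalfPeriod P) :=
  (isOpen_lt continuous_const continuous_coe_real_ereal).inter isOpen_Iio

lemma exists_Ioo_subset_leftHalfPeriod {P : EReal} (hP : 0 < P) :
    ∃ ε > 0, Ioo (-ε) 0 ⊆ leftHalfPeriod P := by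
  induction P with
  | bot => simp at hP
  | top => exact ⟨1, one_pos, fun y hy => mem_leftHalfPeriod_top.2 hy.2⟩
  | coe p =>
    exact ⟨p / 2, half_pos (EReal.coe_pos.1 hP), fun y hy => mem_leftHalfPeriod_coe.2 hy⟩

end Whitham

end

/-! ### The nodal pattern. -/

theorem theorem3p8 (P : EReal) (hP : 0 < P) (μ : ℝ) (φ : ℝ → ℝ)
    (hsol : Whitham.IsSolution μ φ)
    (hper : Whitham.IsPeriodic P φ)
    (hconst : ¬ ∃ c : ℝ, ∀ x, φ x = c)
    (heven : Function.Even φ)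
    (hBUC : Whitham.BUC 1 φ)
    (hmono : MonotoneOn φ (Whitham.leftHalfPeriod P)) :
    (∀ x ∈ Whitham.leftHalfPeriod P, 0 < deriv φ x ∧ φ x < μ / 2) ∧
    0 < μ ∧
    (Whitham.BUC 2 φ →
      (∀ x, φ x < μ / 2) ∧
      iteratedDeriv 2 φ 0 < 0 ∧
      ∀ p : ℝ, P = (p : EReal) →
        0 < iteratedDeriv 2 φ (p / 2) ∧
        0 < iteratedDeriv 2 φ (-(p / 2)) ∧
        (μ ≤ 1 → μ / 4 ≤ φ 0 →
          ∃ k' : ℝ, HasDerivAt (Whitham.periodicKernel p) k' (p / 4) ∧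
            1 / 2 * |k'| ≤ iteratedDeriv 2 φ (p / 2) - iteratedDeriv 2 φ 0)) := by
  obtain ⟨C, hC⟩ := hsol.bounded
  obtain ⟨C', hC'⟩ := hBUC.bounded_deriv
  have hc := hsol.continuous
  have hc' := hBUC.continuous_deriv
  have hd := hBUC.hasDerivAt
  have hmax := Whitham.le_apply_zero hP hc heven hper hmono
  have hmain : ∀ x ∈ Whitham.leftHalfPeriod P, 0 < deriv φ x ∧ φ x < μ / 2 := by
    intro x hx
    have h1 : 0 < Whitham.L (deriv φ) x := Whitham.L_pos_of_laplace_pos hc' hC' fun s hs => by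
      rw [Whitham.laplace_first_deriv hd hc' hC hC' x hs]
      exact mul_pos hs (Whitham.laplace_diff_pos hP hc hC heven hper hmono hconst hx hs)
    -- Now `(μ - 2φ)φ' > 0`; monotonicity gives `φ' ≥ 0`, so both factors are positive.
    rw [hsol.deriv_eq hd hc' hC hC'] at h1
    have h2 : 0 ≤ deriv φ x := by
      rw [← derivWithin_of_isOpen (Whitham.isOpen_leftHalfPeriod P) hx]
      exact hmono.derivWithin_nonneg
    have h3 : 0 < deriv φ x := lt_of_le_of_ne h2 fun h => by rw [← h] at h1; simp at h1
    have h4 := (mul_pos_iff_of_pos_right h3).1 h1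
    exact ⟨h3, by linarith⟩
  have hzero : φ 0 ≤ μ / 2 := by
    obtain ⟨ε, hε, hsub⟩ := Whitham.exists_Ioo_subset_leftHalfPeriod hP
    have hcl : closure (Set.Ioo (-ε) 0) ⊆ {x | φ x ≤ μ / 2} :=
      closure_minimal (fun x hx => (hmain x (hsub hx)).2.le) (isClosed_le hc continuous_const)
    rw [closure_Ioo (by linarith)] at hcl
    exact hcl ⟨by linarith, le_rfl⟩
  refine ⟨hmain, hsol.speed_pos hC hmax hzero hconst, fun hBUC2 => ?_⟩
  obtain ⟨C'', hC''⟩ := (hBUC2.2 2 le_rfl).2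
  have hc'' := (hBUC2.2 2 le_rfl).1.continuous
  have hd' := hBUC2.hasDerivAt_deriv
  have heq := hsol.second_deriv_eq hd hd' hc'' hC hC' hC''
  have hnd : ∀ t, HasDerivAt (fun t => -φ t) (-deriv φ t) t := fun t => (hd t).neg
  have hnd' : ∀ t, HasDerivAt (fun t => -deriv φ t) (-iteratedDeriv 2 φ t) t := fun t => (hd' t).neg
  have hnC : ∀ t, |-φ t| ≤ C := fun t => (abs_neg _).le.trans (hC t)
  have hnC' : ∀ t, |-deriv φ t| ≤ C' := fun t => (abs_neg _).le.trans (hC' t)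
  have hnC'' : ∀ t, |-iteratedDeriv 2 φ t| ≤ C'' := fun t => (abs_neg _).le.trans (hC'' t)
  have hL0 : Whitham.L (iteratedDeriv 2 φ) 0 < 0 := by
    have := Whitham.L_second_deriv_pos hnd hnd' hc''.neg hnC hnC' hnC'' (x := 0)
      (fun y => neg_le_neg (hmax y)) fun ⟨c, h⟩ => hconst ⟨-c, fun y => by rw [← h y, neg_neg]⟩
    rw [Whitham.L_neg] at this
    linarith
  have hcrit0 : deriv φ 0 = 0 := IsLocalMax.deriv_eq_zero (.of_forall hmax)
  have heq0 := heq 0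
  rw [hcrit0] at heq0
  -- If `φ 0 = μ/2`, the equation at the crest would read `Lφ''(0) = 0`, against `hL0`.
  have hgap0 : 0 < μ - 2 * φ 0 := by
    refine lt_of_le_of_ne (by linarith) fun h => ?_
    rw [← h] at heq0
    linarith
  have hneg0 : iteratedDeriv 2 φ 0 < 0 := by
    by_contra! h
    have := mul_nonneg hgap0.le h
    linarith
  refine ⟨fun x => by linarith [hmax x], hneg0, ?_⟩
  rintro p rfl
  have hp : 0 < p := EReal.coe_pos.1 hP
  have hperp := hper p rfl
  have hmono' : MonotoneOn φ (Set.Ioo (-(p / 2)) 0) :=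
    hmono.mono fun y hy => Whitham.mem_leftHalfPeriod_coe.2 hy
  have hmin : ∀ y, φ (p / 2) ≤ φ y := fun y => by
    obtain ⟨z, hz, hyz⟩ := Whitham.Periodic.exists_abs_le hperp hp y
    have h0 : |p / 2| = p / 2 := abs_of_pos (by positivity)
    rw [hyz]
    exact Whitham.le_of_abs_le hc heven hp hmono' (by rwa [h0]) h0.le
  have hposmin : ∀ x, (∀ y, φ x ≤ φ y) → 0 < iteratedDeriv 2 φ x := fun x hx => by
    have hL := Whitham.L_second_deriv_pos hd hd' hc'' hC hC' hC'' hx hconst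
    have hcrit : deriv φ x = 0 := IsLocalMin.deriv_eq_zero (.of_forall hx)
    rw [heq, hcrit] at hL
    have hgap : 0 < μ - 2 * φ x := by linarith [hx 0]
    have : 0 < (μ - 2 * φ x) * iteratedDeriv 2 φ x := by linarith
    exact (mul_pos_iff_of_pos_left hgap).1 this
  refine ⟨hposmin _ hmin, hposmin _ fun y => by rw [heven]; exact hmin y, fun hμ1 hφ0 => ?_⟩
  refine ⟨_, Whitham.hasDerivAt_periodicKernel hp, ?_⟩
  have hκ := Whitham.quarterSlope_nonneg hp
  rw [abs_neg, abs_of_nonneg hκ]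
  have hq : |p / 4| = p / 4 := abs_of_pos (by positivity)
  have hshift : ∀ t, φ (p - t) = φ t := fun t => by
    rw [hperp.sub_eq', heven]
  have hfar : ∀ t ∈ Set.Icc (p / 4) (3 * p / 4), φ t ≤ φ (p / 4) := fun t ht => by
    rcases le_total t (p / 2) with h | h
    · have h0 : |t| = t := abs_of_nonneg (by linarith [ht.1])
      exact Whitham.le_of_abs_le hc heven hp hmono' (by rw [h0, hq]; exact ht.1) (by rwa [h0])
    · have h0 : |p - t| = p - t := abs_of_nonneg (by linarith [ht.2])
      rw [← hshift t]
      exact Whitham.le_of_abs_le hc heven hp hmono' (by rw [h0, hq]; linarith [ht.2])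
        (by rw [h0]; linarith)
  have hnear : ∀ t, |t| ≤ p / 4 → φ (p / 4) ≤ φ t := fun t ht =>
    Whitham.le_of_abs_le hc heven hp hmono' (by rwa [hq]) (by rw [hq]; linarith)
  -- The value `φ (p/4)` separates the two halves: it bounds `φ` above at distance at least `p/4`
  -- from the crest, and below at distance at least `p/4` from the trough. It cancels when the two
  -- estimates are added.
  have hA := Whitham.le_L_second_deriv hnd hnd' hc''.neg hnC hnC' hnC'' (x := 0)
    (c := -φ (p / 4)) hp (fun t => by rw [hperp t]) (fun y => neg_le_neg (hmax y)) fun t ht => by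
      rw [zero_add, zero_sub, heven]
      linarith [hfar t ht]
  have hB := Whitham.le_L_second_deriv hd hd' hc'' hC hC' hC'' (x := p / 2)
    (c := φ (p / 4)) hp hperp hmin fun t ht => by
      have h1 : φ (p / 2 + t) = φ (p / 2 - t) := by
        rw [← hshift (p / 2 + t)]; congr 1; ring
      rw [h1]
      linarith [hnear (p / 2 - t) (abs_le.2 ⟨by linarith [ht.2], by linarith [ht.1]⟩)]
  rw [Whitham.L_neg, heq0] at hA
  have hcritp : deriv φ (p / 2) = 0 := IsLocalMin.deriv_eq_zero (.of_forall hmin)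
  rw [heq, hcritp] at hB
  have hm0 := hsol.min_nonpos hC hmin hμ1
  have hgapp : 0 < μ - 2 * φ (p / 2) := by linarith [hmax (p / 2)]
  have hA' : 2 * (φ 0 - φ (p / 4)) * Whitham.quarterSlope p ≤
      (μ - 2 * φ (p / 2)) * -iteratedDeriv 2 φ 0 := by
    -- The crest factor is enlarged to the trough factor so that both estimates carry the same one.
    have : (μ - 2 * φ 0) * -iteratedDeriv 2 φ 0 ≤ (μ - 2 * φ (p / 2)) * -iteratedDeriv 2 φ 0 :=
      mul_le_mul_of_nonneg_right (by linarith [hmax (p / 2)]) (by linarith)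
    linarith
  have hsum : 2 * (φ 0 - φ (p / 2)) * Whitham.quarterSlope p ≤
      (μ - 2 * φ (p / 2)) * (iteratedDeriv 2 φ (p / 2) - iteratedDeriv 2 φ 0) := by linarith
  -- The factor `1/2` amounts to `φ(p/2) ≤ 2φ(0) - μ/2`, where the left side is at most `0` because
  -- `μ ≤ 1` and the right side is at least `0` because `φ(0) ≥ μ/4`.
  have hratio : (μ - 2 * φ (p / 2)) * (1 / 2 * Whitham.quarterSlope p) ≤
      2 * (φ 0 - φ (p / 2)) * Whitham.quarterSlope p := by
    have := mul_le_mul_of_nonneg_right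
      (by linarith : (μ - 2 * φ (p / 2)) * (1 / 2) ≤ 2 * (φ 0 - φ (p / 2))) hκ
    linarith
  exact le_of_mul_le_mul_left (hratio.trans hsum) hgapp
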